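/- Conventions. Let $G$ be a discrete group and let $\mathcal B=(B_g)_{g\in G}$ be a Fell bundle over $G$. Write $C^*(\mathcal B)$ for its full cross-sectional $C^*$-algebra, that is, the completion of the $*$-algebra of finitely supported sections in its largest $C^*$-seminorm, and regard elements of $B_g$ also as elements of $C^*(\mathcal B)$ through the canonical map $B_g\to C^*(\mathcal B)$. For $\mathfrak t=(t_1,\dots,t_n)\in G^n$ let $\mathbb M_{\mathfrak t}(\mathcal B)$ be the $C^*$-algebra of $n\times n$ matrices $M$ with $M_{i,j}\in B_{t_i^{-1}t_j}$, with the usual matrix operations. A fibrewise linear map $\phi\colon\mathcal B\to\mathbb B(H)$, $H$ a Hilbert space, is completely positive (cp) if $\phi^{\mathfrak t}\colon \mathbb M_{\mathfrak t}(\mathcal B)\to\mathbb M_n(\mathbb B(H))$, $(M_{i,j})\mapsto(\phi(M_{i,j}))$, is positive for all $n$ and all $\mathfrak t\in G^n$; its norm is $\|\phi\|=\sup\{\|\phi(b)\|: b\in\mathcal B,\ \|b\|\le 1\}$. A representation $\pi=\{\pi_g\}_{g\in G}$ of a Fell bundle $\mathcal C=(C_g)_{g\in G}$ on $H$ is a family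 of linear maps $\pi_g\colon C_g\to\mathbb B(H)$ with $\pi_{gh}(cd)=\pi_g(c)\pi_h(d)$ and $\pi_{g^{-1}}(c^*)=\pi_g(c)^*$ for all $c\in C_g$, $d\in C_h$; it is faithful if $\pi_e$ is injective; its integrated form $C^*(\mathcal C)\to\mathbb B(H)$ is again denoted $\pi$. Statement. Let $\phi\colon\mathcal B\to\mathbb B(H)$ be a cp map. Then $\|\phi\|<\infty$ and: 1. There is a cp map $\tilde\phi\colon C^*(\mathcal B)\to\mathbb B(H)$ with $\tilde\phi(b)=\phi(b)$ for all $g\in G$, $b\in B_g$, and with $\|\tilde\phi\|=\|\phi\|$; it is the only cp map on $C^*(\mathcal B)$ that restricts to $\phi$. 2. Let $\mathcal C=(C_g)_{g\in G}$ be a Fell bundle over $G$ and let $\pi=\{\pi_g\}_{g\in G}$ be a faithful representation of $\mathcal C$ on $H$ such that $\phi(B_g)\subseteq\pi_g(C_g)$ for all $g\in G$. Then there is a cp map $\phi'\colon C^*(\mathcal B)\to C^*(\mathcal C)$ with $\|\phi'\|=\|\phi\|$ such that, for all $g\in G$ and $b\in B_g$, $\phi'(b)\in C_g$ and $\pi(\phi'(b))=\phi(b)$.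 -/

import Mathlib

open scoped CStarAlgebra ENNReal DirectSum

set_option linter.unusedSectionVars false

universe u v w x

noncomputable section

/-! ## C*-seminorms on *-algebras and the associated C*-completions -/

/-- A C*-seminorm on a complex *-algebra. -/
structure CStarSeminorm (E : Type*) [NonUnitalRing E] [StarRing E] [Module ℂ E]
    extends Seminorm ℂ E where
  map_mul_le' : ∀ x y, toFun (x * y) ≤ toFun x * toFun y
  map_star' : ∀ x, toFun (star x) = toFun x
  map_star_mul_self' : ∀ x, toFun (star x * x) = toFun x ^ 2

namespace CStarSeminorm

variable {E : Type*} [NonUnitalRing E] [StarRing E] [Module ℂ E]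

/-- The *-algebra `E`, regarded as a seminormed algebra through the C*-seminorm `p`. -/
def Pre (_p : CStarSeminorm E) : Type _ := E

variable (p : CStarSeminorm E)

instance : NonUnitalRing p.Pre := inferInstanceAs (NonUnitalRing E)
instance : StarRing p.Pre := inferInstanceAs (StarRing E)
instance : Module ℂ p.Pre := inferInstanceAs (Module ℂ E)

instance : SeminormedAddCommGroup p.Pre :=
  AddGroupSeminorm.toSeminormedAddCommGroup (E := p.Pre) p.toSeminorm.toAddGroupSeminorm

theorem norm_def (x : p.Pre) : ‖x‖ = p.toSeminorm x := rfl

instance : NonUnitalSeminormedRing p.Pre where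
  __ := (inferInstance : SeminormedAddCommGroup p.Pre)
  __ := (inferInstance : NonUnitalRing p.Pre)
  norm_mul_le := p.map_mul_le'

instance : NormedSpace ℂ p.Pre where
  norm_smul_le c x := (map_smul_eq_mul p.toSeminorm c x).le

theorem norm_star_pre (x : p.Pre) : ‖star x‖ = ‖x‖ := p.map_star' x

theorem norm_star_mul_self_pre (x : p.Pre) : ‖star x * x‖ = ‖x‖ ^ 2 := p.map_star_mul_self' x

/-- The C*-algebra obtained from `E` by (Hausdorff) completion with respect to `p`. -/
abbrev Completion : Type _ := UniformSpace.Completion p.Pre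

/-- The canonical map from `E` to its completion. -/
def toCompletion : E →ₗ[ℂ] p.Completion where
  toFun x := ((show p.Pre from x : p.Pre) : UniformSpace.Completion p.Pre)
  map_add' x y := UniformSpace.Completion.coe_add (α := p.Pre) x y
  map_smul' c x := UniformSpace.Completion.coe_smul (X := p.Pre) c x

theorem norm_toCompletion (x : E) : ‖p.toCompletion x‖ = p.toSeminorm x :=
  UniformSpace.Completion.norm_coe (E := p.Pre) x

theorem denseRange_toCompletion : DenseRange p.toCompletion :=
  UniformSpace.Completion.denseRange_coe (α := p.Pre)

@[elab_as_elim]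
theorem completion_induction {P : p.Completion → Prop} (x : p.Completion)
    (hP : IsClosed {x | P x}) (h : ∀ y, P (p.toCompletion y)) : P x :=
  UniformSpace.Completion.induction_on (α := p.Pre) x hP h

instance : Mul p.Completion :=
  ⟨Function.curry <| ((UniformSpace.Completion.isDenseInducing_coe (α := p.Pre)).prodMap
    (UniformSpace.Completion.isDenseInducing_coe (α := p.Pre))).extend
      (fun z : p.Pre × p.Pre => p.toCompletion (z.1 * z.2))⟩

theorem continuous_toCompletion : Continuous (fun x : p.Pre => p.toCompletion x) :=
  UniformSpace.Completion.continuous_coe p.Pre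

theorem toCompletion_mul (x y : E) :
    p.toCompletion (x * y) = p.toCompletion x * p.toCompletion y :=
  (((UniformSpace.Completion.isDenseInducing_coe (α := p.Pre)).prodMap
    (UniformSpace.Completion.isDenseInducing_coe (α := p.Pre))).extend_eq
      (f := fun z : p.Pre × p.Pre => p.toCompletion (z.1 * z.2))
      (p.continuous_toCompletion.comp continuous_mul) (x, y)).symm

instance : ContinuousMul p.Completion where
  continuous_mul := by
    let m := (AddMonoidHom.mul : p.Pre →+ p.Pre →+ p.Pre).compr₂
      (UniformSpace.Completion.toCompl : p.Pre →+ UniformSpace.Completion p.Pre)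
    have : Continuous fun z : p.Pre × p.Pre => m z.1 z.2 :=
      p.continuous_toCompletion.comp continuous_mul
    have di : IsDenseInducing
      (UniformSpace.Completion.toCompl : p.Pre → UniformSpace.Completion p.Pre) :=
      UniformSpace.Completion.isDenseInducing_coe
    exact (di.extend_Z_bilin di this :)

/-- The involution on the completion, as an additive map. -/
def starHom : p.Pre →+ p.Pre := (starAddEquiv : p.Pre ≃+ p.Pre).toAddMonoidHom

theorem continuous_starHom : Continuous p.starHom :=
  AddMonoidHomClass.continuous_of_bound p.starHom 1
    (fun x => by rw [one_mul]; exact (p.norm_star_pre x).le)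

instance : Star p.Completion :=
  ⟨fun x => p.starHom.completion p.continuous_starHom x⟩

theorem continuous_star' : Continuous (fun x : p.Completion => star x) :=
  AddMonoidHom.continuous_completion p.starHom p.continuous_starHom

theorem toCompletion_star (x : E) : p.toCompletion (star x) = star (p.toCompletion x) :=
  (AddMonoidHom.completion_coe p.starHom p.continuous_starHom x).symm

theorem completion_induction₂ {P : p.Completion → p.Completion → Prop} (x y : p.Completion)
    (hP : IsClosed {z : p.Completion × p.Completion | P z.1 z.2})
    (h : ∀ x y, P (p.toCompletion x) (p.toCompletion y)) : P x y :=
  UniformSpace.Completion.induction_on₂ (α := p.Pre) (β := p.Pre) x y hP h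

theorem completion_induction₃ {P : p.Completion → p.Completion → p.Completion → Prop}
    (x y z : p.Completion)
    (hP : IsClosed {z : p.Completion × p.Completion × p.Completion | P z.1 z.2.1 z.2.2})
    (h : ∀ x y z, P (p.toCompletion x) (p.toCompletion y) (p.toCompletion z)) : P x y z :=
  UniformSpace.Completion.induction_on₃ (α := p.Pre) (β := p.Pre) (γ := p.Pre) x y z hP h

instance : NonUnitalRing p.Completion where
  __ := (inferInstance : AddCommGroup p.Completion)
  __ := (inferInstance : Mul p.Completion)
  zero_mul a := p.completion_induction a (isClosed_eq (by fun_prop) continuous_const)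
    fun a => by rw [← map_zero p.toCompletion, ← toCompletion_mul, zero_mul]
  mul_zero a := p.completion_induction a (isClosed_eq (by fun_prop) continuous_const)
    fun a => by rw [← map_zero p.toCompletion, ← toCompletion_mul, mul_zero]
  mul_assoc a b c := p.completion_induction₃ (P := fun a b c => a * b * c = a * (b * c)) a b c
    (isClosed_eq (by fun_prop) (by fun_prop))
    fun a b c => by simp only [← toCompletion_mul, mul_assoc]
  left_distrib a b c := p.completion_induction₃
    (P := fun a b c => a * (b + c) = a * b + a * c) a b c
    (isClosed_eq (by fun_prop) (by fun_prop))
    fun a b c => by simp only [← toCompletion_mul, ← map_add, mul_add]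
  right_distrib a b c := p.completion_induction₃
    (P := fun a b c => (a + b) * c = a * c + b * c) a b c
    (isClosed_eq (by fun_prop) (by fun_prop))
    fun a b c => by simp only [← toCompletion_mul, ← map_add, add_mul]

instance : NonUnitalNormedRing p.Completion where
  __ := (inferInstance : NormedAddCommGroup p.Completion)
  __ := (inferInstance : NonUnitalRing p.Completion)
  norm_mul_le x y := p.completion_induction₂ (P := fun x y => ‖x * y‖ ≤ ‖x‖ * ‖y‖) x y
    (isClosed_le (by fun_prop) (by fun_prop))
    fun x y => by
      rw [← toCompletion_mul, norm_toCompletion, norm_toCompletion, norm_toCompletion]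
      exact p.map_mul_le' x y

instance : StarRing p.Completion where
  star_involutive x := p.completion_induction x
    (isClosed_eq (p.continuous_star'.comp p.continuous_star') continuous_id)
    fun x => by rw [← toCompletion_star, ← toCompletion_star, star_star]
  star_mul x y := p.completion_induction₂ (P := fun x y => star (x * y) = star y * star x) x y
    (isClosed_eq (p.continuous_star'.comp continuous_mul)
      ((p.continuous_star'.comp continuous_snd).mul (p.continuous_star'.comp continuous_fst)))
    fun x y => by simp only [← toCompletion_mul, ← toCompletion_star, star_mul]
  star_add x y := map_add (p.starHom.completion p.continuous_starHom) x y

instance : CStarRing p.Completion where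
  norm_mul_self_le x := p.completion_induction x
    (isClosed_le (by fun_prop) (continuous_norm.comp (p.continuous_star'.mul continuous_id)))
    fun x => by
      rw [← toCompletion_star, ← toCompletion_mul, norm_toCompletion, norm_toCompletion]
      exact (sq (p.toSeminorm x) ▸ p.map_star_mul_self' x).ge

/-- `p.Completion` is a C*-algebra. The assumptions say that `E` is a complex *-algebra. -/
instance [IsScalarTower ℂ E E] [SMulCommClass ℂ E E] [StarModule ℂ E] :
    NonUnitalCStarAlgebra p.Completion where
  smul_assoc c x y := by
    change (c • x) * y = c • (x * y)
    exact p.completion_induction₂ (P := fun x y => (c • x) * y = c • (x * y)) x y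
      (isClosed_eq ((continuous_fst.const_smul c).mul continuous_snd)
        (continuous_mul.const_smul c))
      fun x y => by simp only [← map_smul, ← toCompletion_mul, smul_mul_assoc]
  smul_comm c x y := by
    change c • (x * y) = x * (c • y)
    exact p.completion_induction₂ (P := fun x y => c • (x * y) = x * (c • y)) x y
      (isClosed_eq (continuous_mul.const_smul c)
        (continuous_fst.mul (continuous_snd.const_smul c)))
      fun x y => by simp only [← map_smul, ← toCompletion_mul, mul_smul_comm]
  star_smul c x := p.completion_induction x
    (isClosed_eq (p.continuous_star'.comp (continuous_const_smul c))
      (p.continuous_star'.const_smul (star c)))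
    fun x => by simp only [← map_smul, ← toCompletion_star, star_smul]

/-- Every C*-seminorm on a C*-algebra is dominated by the norm. -/
theorem le_norm {A : Type*} [NonUnitalCStarAlgebra A] (p : CStarSeminorm A) (x : A) :
    p.toSeminorm x ≤ ‖x‖ := by
  let f : A →⋆ₙₐ[ℂ] p.Completion :=
    { toFun := p.toCompletion
      map_smul' := map_smul p.toCompletion
      map_zero' := map_zero p.toCompletion
      map_add' := map_add p.toCompletion
      map_mul' := p.toCompletion_mul
      map_star' := p.toCompletion_star }
  rw [← p.norm_toCompletion]
  exact NonUnitalStarAlgHom.norm_apply_le f x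

/-- A *-homomorphism into a C*-algebra that is dominated by `p` extends to the completion. -/
def extend [IsScalarTower ℂ E E] [SMulCommClass ℂ E E] [StarModule ℂ E]
    {A : Type*} [NonUnitalCStarAlgebra A] (f : E →⋆ₙₐ[ℂ] A)
    (hf : ∀ x, ‖f x‖ ≤ p.toSeminorm x) : p.Completion →⋆ₙₐ[ℂ] A :=
  let f₀ : p.Pre →+ A :=
    { toFun := fun x => f x, map_zero' := map_zero f, map_add' := map_add f }
  have hc : Continuous f₀ :=
    AddMonoidHomClass.continuous_of_bound f₀ 1 (fun x => by rw [one_mul]; exact hf x)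
  have hC : Continuous (f₀.extension hc) := AddMonoidHom.continuous_extension f₀ hc
  have hx : ∀ x, f₀.extension hc (p.toCompletion x) = f x := AddMonoidHom.extension_coe f₀ hc
  { toFun := f₀.extension hc
    map_smul' := fun c x => p.completion_induction x
      (isClosed_eq (hC.comp (continuous_const_smul c)) (hC.const_smul c))
      fun x => by
        rw [← map_smul, hx, map_smul, hx]; rfl
    map_zero' := map_zero _
    map_add' := map_add _
    map_mul' := fun x y => p.completion_induction₂
      (P := fun x y => f₀.extension hc (x * y) = f₀.extension hc x * f₀.extension hc y) x y
      (isClosed_eq (hC.comp continuous_mul)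
        ((hC.comp continuous_fst).mul (hC.comp continuous_snd)))
      fun x y => by rw [← toCompletion_mul, hx, hx, hx, map_mul]
    map_star' := fun x => p.completion_induction x
      (isClosed_eq (hC.comp p.continuous_star') (continuous_star.comp hC))
      fun x => by rw [← toCompletion_star, hx, hx, map_star] }

theorem extend_toCompletion [IsScalarTower ℂ E E] [SMulCommClass ℂ E E] [StarModule ℂ E]
    {A : Type*} [NonUnitalCStarAlgebra A] (f : E →⋆ₙₐ[ℂ] A)
    (hf : ∀ x, ‖f x‖ ≤ p.toSeminorm x) (x : E) :
    p.extend f hf (p.toCompletion x) = f x :=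
  let f₀ : p.Pre →+ A :=
    { toFun := fun x => f x, map_zero' := map_zero f, map_add' := map_add f }
  AddMonoidHom.extension_coe f₀
    (AddMonoidHomClass.continuous_of_bound f₀ 1 (fun x => by rw [one_mul]; exact hf x)) x

end CStarSeminorm

/-! ## Fell bundles over discrete groups -/

/-- A Fell bundle over the (discrete) group `G`: a family of complex Banach spaces `B g` with
bilinear multiplication maps `B g × B h → B (g * h)` and conjugate-linear involutions
`B g → B g⁻¹`, subject to the usual axioms. Identities whose two sides lie in the fibres over
`s` and `t`, where `s = t` holds only propositionally, are stated in the total space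
`Σ g, B g`. -/
class FellBundle {G : Type u} [Group G] (B : G → Type v) [∀ g, NormedAddCommGroup (B g)]
    [∀ g, NormedSpace ℂ (B g)] [∀ g, CompleteSpace (B g)] where
  mul : ∀ {g h : G}, B g →ₗ[ℂ] B h →ₗ[ℂ] B (g * h)
  adj : ∀ {g : G}, B g →ₗ⋆[ℂ] B g⁻¹
  mul_assoc : ∀ {g h k : G} (a : B g) (b : B h) (c : B k),
    (⟨_, mul (mul a b) c⟩ : Sigma B) = ⟨_, mul a (mul b c)⟩
  norm_mul_le : ∀ {g h : G} (a : B g) (b : B h), ‖mul a b‖ ≤ ‖a‖ * ‖b‖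
  adj_adj : ∀ {g : G} (a : B g), (⟨_, adj (adj a)⟩ : Sigma B) = ⟨_, a⟩
  adj_mul : ∀ {g h : G} (a : B g) (b : B h),
    (⟨_, adj (mul a b)⟩ : Sigma B) = ⟨_, mul (adj b) (adj a)⟩
  norm_adj : ∀ {g : G} (a : B g), ‖adj a‖ = ‖a‖
  norm_adj_mul_self : ∀ {g : G} (a : B g), ‖mul (adj a) a‖ = ‖a‖ ^ 2
  /-- `a* a` is a positive element of the unit fibre C*-algebra. -/
  adj_mul_self_nonneg : ∀ {g : G} (a : B g), ∃ c : B (1 : G),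
    (⟨_, mul (adj a) a⟩ : Sigma B) = ⟨_, mul (adj c) c⟩

namespace FellBundle

variable {G : Type u} [Group G]

/-- Transport between fibres along an equality of group elements. -/
def fcast {B : G → Type v} {g h : G} (e : g = h) (b : B g) : B h := e ▸ b

theorem sigma_fcast {B : G → Type v} {g h : G} (e : g = h) (b : B g) :
    (⟨h, fcast e b⟩ : Sigma B) = ⟨g, b⟩ := by subst e; rfl

theorem eq_of_sigma_eq {B : G → Type v} {g : G} {a b : B g}
    (h : (⟨g, a⟩ : Sigma B) = ⟨g, b⟩) : a = b := eq_of_heq (Sigma.mk.inj_iff.mp h).2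

variable (B : G → Type v) [∀ g, NormedAddCommGroup (B g)] [∀ g, NormedSpace ℂ (B g)]

theorem norm_eq_of_sigma_eq {g h : G} {a : B g} {b : B h}
    (e : (⟨g, a⟩ : Sigma B) = ⟨h, b⟩) : ‖a‖ = ‖b‖ :=
  congrArg (fun z : Sigma B => ‖z.2‖) e

theorem fcast_add {g h : G} (e : g = h) (a b : B g) :
    fcast e (a + b) = fcast e a + fcast e b := by subst e; rfl

theorem fcast_smul {g h : G} (e : g = h) (c : ℂ) (a : B g) :
    fcast e (c • a) = c • fcast e a := by subst e; rfl

variable [∀ g, CompleteSpace (B g)] [FellBundle B]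

theorem sigma_mul_congr {g g' h h' : G} {a : B g} {a' : B g'} {b : B h} {b' : B h'}
    (e : (⟨g, a⟩ : Sigma B) = ⟨g', a'⟩) (f : (⟨h, b⟩ : Sigma B) = ⟨h', b'⟩) :
    (⟨_, mul a b⟩ : Sigma B) = ⟨_, mul a' b'⟩ := by
  cases e; cases f; rfl

theorem sigma_adj_congr {g g' : G} {a : B g} {a' : B g'}
    (e : (⟨g, a⟩ : Sigma B) = ⟨g', a'⟩) :
    (⟨_, adj a⟩ : Sigma B) = ⟨_, adj a'⟩ := by
  cases e; rfl

/-! ### The unit fibre C*-algebra -/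

/-- The fibre over the unit, with its C*-algebra structure. -/
abbrev unitFibre : NonUnitalCStarAlgebra (B (1 : G)) where
  __ := (inferInstance : NormedAddCommGroup (B (1 : G)))
  __ := (inferInstance : NormedSpace ℂ (B (1 : G)))
  __ := (inferInstance : CompleteSpace (B (1 : G)))
  mul a b := fcast (one_mul 1) (mul a b)
  star a := fcast inv_one (adj a)
  left_distrib a b c := by
    change fcast _ (mul a (b + c)) = fcast _ (mul a b) + fcast _ (mul a c)
    rw [map_add, fcast_add]
  right_distrib a b c := by
    change fcast _ (mul (a + b) c) = fcast _ (mul a c) + fcast _ (mul b c)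
    rw [map_add, LinearMap.add_apply, fcast_add]
  zero_mul a := by
    change fcast _ (mul (0 : B (1 : G)) a) = 0
    rw [map_zero, LinearMap.zero_apply, ← zero_smul ℂ (0 : B ((1 : G) * 1)), fcast_smul, zero_smul]
  mul_zero a := by
    change fcast _ (mul a (0 : B (1 : G))) = 0
    rw [map_zero, ← zero_smul ℂ (0 : B ((1 : G) * 1)), fcast_smul, zero_smul]
  mul_assoc a b c := by
    change fcast _ (mul (fcast _ (mul a b)) c) = fcast _ (mul a (fcast _ (mul b c)))
    apply eq_of_sigma_eq
    rw [sigma_fcast, sigma_fcast]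
    exact (sigma_mul_congr B (sigma_fcast _ _) rfl).trans
      ((mul_assoc a b c).trans (sigma_mul_congr B rfl (sigma_fcast _ _).symm))
  norm_mul_le a b := by
    change ‖fcast _ (mul a b)‖ ≤ ‖a‖ * ‖b‖
    rw [norm_eq_of_sigma_eq B (sigma_fcast _ _)]
    exact norm_mul_le a b
  star_involutive a := by
    change fcast _ (adj (fcast _ (adj a))) = a
    apply eq_of_sigma_eq
    rw [sigma_fcast]
    exact (sigma_adj_congr B (sigma_fcast _ _)).trans (adj_adj a)
  star_mul a b := by
    change fcast _ (adj (fcast _ (mul a b))) = fcast _ (mul (fcast _ (adj b)) (fcast _ (adj a)))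
    apply eq_of_sigma_eq
    rw [sigma_fcast, sigma_fcast]
    exact (sigma_adj_congr B (sigma_fcast _ _)).trans
      ((adj_mul a b).trans (sigma_mul_congr B (sigma_fcast _ _).symm (sigma_fcast _ _).symm))
  star_add a b := by
    change fcast _ (adj (a + b)) = fcast _ (adj a) + fcast _ (adj b)
    rw [map_add, fcast_add]
  norm_mul_self_le a := by
    change ‖a‖ * ‖a‖ ≤ ‖fcast _ (mul (fcast _ (adj a)) a)‖
    rw [norm_eq_of_sigma_eq B (sigma_fcast _ _),
      norm_eq_of_sigma_eq B (sigma_mul_congr B (sigma_fcast _ (adj a)) rfl),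
      norm_adj_mul_self, sq]
  smul_assoc c a b := by
    change fcast _ (mul (c • a) b) = c • fcast _ (mul a b)
    rw [map_smul, LinearMap.smul_apply, fcast_smul]
  smul_comm c a b := by
    change c • fcast _ (mul a b) = fcast _ (mul a (c • b))
    rw [map_smul, fcast_smul]
  star_smul c a := by
    change fcast _ (adj (c • a)) = star c • fcast _ (adj a)
    rw [map_smulₛₗ, fcast_smul]; rfl

/-! ### The *-algebra of finitely supported sections -/

/-- The finitely supported sections of the bundle. -/
abbrev Cc : Type (max u v) := ⨁ g, B g

variable {B}

open scoped Classical in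
/-- The section supported at `g` with value `b`. -/
def single {g : G} : B g →ₗ[ℂ] Cc B := DirectSum.lof ℂ G B g

theorem single_congr {g h : G} {a : B g} {b : B h} (e : (⟨g, a⟩ : Sigma B) = ⟨h, b⟩) :
    single a = single b := congrArg (fun z : Sigma B => single z.2) e

open scoped Classical in
theorem Cc.induction {P : Cc B → Prop} (x : Cc B) (zero : P 0)
    (single : ∀ (g : G) (b : B g), P (single b)) (add : ∀ x y, P x → P y → P (x + y)) : P x := by
  exact DirectSum.induction_on x zero (fun g b => single g b) add

open scoped Classical in
/-- The linear extension to sections of a fibrewise linear map. -/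
def Cc.lift {A : Type*} [AddCommGroup A] [Module ℂ A] (φ : ∀ g, B g →ₗ[ℂ] A) : Cc B →ₗ[ℂ] A :=
  DirectSum.toModule ℂ G A φ

theorem Cc.lift_single {A : Type*} [AddCommGroup A] [Module ℂ A] (φ : ∀ g, B g →ₗ[ℂ] A)
    {g : G} (b : B g) : Cc.lift φ (single b) = φ g b := by
  classical exact DirectSum.toModule_lof ℂ g b

/-- The convolution product of sections, as a bilinear map. -/
def Cc.mulHom : Cc B →ₗ[ℂ] Cc B →ₗ[ℂ] Cc B :=
  Cc.lift fun _ => LinearMap.flip (Cc.lift fun _ => LinearMap.flip (mul.compr₂ single))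

instance : Mul (Cc B) := ⟨fun x y => Cc.mulHom x y⟩

theorem Cc.mul_def (x y : Cc B) : x * y = Cc.mulHom x y := rfl

theorem single_mul_single {g h : G} (a : B g) (b : B h) :
    single a * single b = single (mul a b) := by
  simp [Cc.mul_def, Cc.mulHom, Cc.lift_single]

instance : NonUnitalRing (Cc B) where
  __ := (inferInstance : AddCommGroup (Cc B))
  left_distrib x y z := map_add (Cc.mulHom x) y z
  right_distrib x y z := by simp [Cc.mul_def]
  zero_mul x := by simp [Cc.mul_def]
  mul_zero x := map_zero (Cc.mulHom x)
  mul_assoc x y z := by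
    induction x using Cc.induction with
    | zero => simp [Cc.mul_def]
    | add x x' hx hx' => simp only [Cc.mul_def, map_add, LinearMap.add_apply] at *; rw [hx, hx']
    | single g a =>
      induction y using Cc.induction with
      | zero => simp [Cc.mul_def]
      | add y y' hy hy' => simp only [Cc.mul_def, map_add, LinearMap.add_apply] at *; rw [hy, hy']
      | single h b =>
        induction z using Cc.induction with
        | zero => simp [Cc.mul_def]
        | add z z' hz hz' => simp only [Cc.mul_def, map_add] at *; rw [hz, hz']
        | single k c =>
          rw [single_mul_single, single_mul_single, single_mul_single, single_mul_single]
          exact single_congr (mul_assoc a b c)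

instance : IsScalarTower ℂ (Cc B) (Cc B) where
  smul_assoc c x y := by
    change (c • x) * y = c • (x * y)
    simp [Cc.mul_def]

instance : SMulCommClass ℂ (Cc B) (Cc B) where
  smul_comm c x y := (map_smul (Cc.mulHom x) c y).symm

open scoped Classical in
/-- The involution on sections, as an additive map. -/
def Cc.starHom : Cc B →+ Cc B :=
  DirectSum.toAddMonoid fun _ => (single.comp adj : _ →ₗ⋆[ℂ] Cc B).toAddMonoidHom

instance : Star (Cc B) := ⟨Cc.starHom⟩

theorem star_single {g : G} (a : B g) : star (single a) = single (adj a) := by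
  classical exact DirectSum.toAddMonoid_of _ g a

theorem Cc.star_add' (x y : Cc B) : star (x + y) = star x + star y := map_add Cc.starHom x y

theorem Cc.star_zero' : star (0 : Cc B) = 0 := map_zero Cc.starHom

instance : StarRing (Cc B) where
  star_involutive x := by
    induction x using Cc.induction with
    | zero => rw [Cc.star_zero', Cc.star_zero']
    | add x y hx hy => rw [Cc.star_add', Cc.star_add', hx, hy]
    | single g a => rw [star_single, star_single]; exact single_congr (adj_adj a)
  star_mul x y := by
    induction x using Cc.induction with
    | zero => rw [zero_mul, Cc.star_zero', mul_zero]
    | add x x' hx hx' => rw [add_mul, Cc.star_add', Cc.star_add', hx, hx', mul_add]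
    | single g a =>
      induction y using Cc.induction with
      | zero => rw [mul_zero, Cc.star_zero', zero_mul]
      | add y y' hy hy' => rw [mul_add, Cc.star_add', Cc.star_add', hy, hy', add_mul]
      | single h b =>
        rw [single_mul_single, star_single, star_single, star_single, single_mul_single]
        exact single_congr (adj_mul a b)
  star_add := Cc.star_add'

instance : StarModule ℂ (Cc B) where
  star_smul c x := by
    induction x using Cc.induction with
    | zero => rw [smul_zero, star_zero, smul_zero]
    | add x y hx hy => rw [smul_add, star_add, star_add, hx, hy, smul_add]
    | single g a =>
      rw [← map_smul, star_single, star_single, map_smulₛₗ, map_smul]; rfl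

/-! ### The full cross-sectional C*-algebra -/

theorem seminorm_single_le (p : CStarSeminorm (Cc B)) {g : G} (b : B g) :
    p.toSeminorm (single b) ≤ ‖b‖ := by
  let := unitFibre B
  have hmul (x y : B (1 : G)) : single (x * y) = single x * single y :=
    (single_congr (sigma_fcast _ _)).trans (single_mul_single x y).symm
  have hstar (x : B (1 : G)) : single (star x) = star (single x) :=
    (single_congr (sigma_fcast _ _)).trans (star_single x).symm
  let q : CStarSeminorm (B (1 : G)) :=
    { p.toSeminorm.comp (single (g := 1)) with
      map_mul_le' := fun x y => by
        change p.toSeminorm (single (x * y)) ≤ _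
        rw [hmul]; exact p.map_mul_le' _ _
      map_star' := fun x => by
        change p.toSeminorm (single (star x)) = _
        rw [hstar]; exact p.map_star' _
      map_star_mul_self' := fun x => by
        change p.toSeminorm (single (star x * x)) = _
        rw [hmul, hstar]; exact p.map_star_mul_self' _ }
  have key : p.toSeminorm (single b) ^ 2 ≤ ‖b‖ ^ 2 := by
    have e : g⁻¹ * g = 1 := inv_mul_cancel g
    calc p.toSeminorm (single b) ^ 2 = p.toSeminorm (star (single b) * single b) :=
          (p.map_star_mul_self' _).symm
      _ = q.toSeminorm (fcast e (mul (adj b) b)) := by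
          rw [star_single, single_mul_single, ← single_congr (sigma_fcast e _)]; rfl
      _ ≤ ‖fcast e (mul (adj b) b)‖ := q.le_norm _
      _ = ‖b‖ ^ 2 := by rw [norm_eq_of_sigma_eq B (sigma_fcast _ _), norm_adj_mul_self]
  exact (pow_le_pow_iff_left₀ (apply_nonneg _ _) (norm_nonneg _) two_ne_zero).mp key

theorem bddAbove_seminorm (x : Cc B) :
    BddAbove (Set.range fun p : CStarSeminorm (Cc B) => p.toSeminorm x) := by
  induction x using Cc.induction with
  | zero => exact ⟨0, by rintro _ ⟨p, rfl⟩; simp⟩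
  | single g b => exact ⟨‖b‖, by rintro _ ⟨p, rfl⟩; exact seminorm_single_le p b⟩
  | add x y hx hy =>
    obtain ⟨K, hK⟩ := hx
    obtain ⟨L, hL⟩ := hy
    refine ⟨K + L, ?_⟩
    rintro _ ⟨p, rfl⟩
    exact (map_add_le_add p.toSeminorm x y).trans (add_le_add (hK ⟨p, rfl⟩) (hL ⟨p, rfl⟩))

instance : Nonempty (CStarSeminorm (Cc B)) :=
  ⟨{ (0 : Seminorm ℂ (Cc B)) with
      map_mul_le' := fun _ _ => (mul_zero (0 : ℝ)).ge
      map_star' := fun _ => rfl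
      map_star_mul_self' := fun _ => (zero_pow two_ne_zero (M₀ := ℝ)).symm }⟩

theorem iSup_seminorm_nonneg (x : Cc B) :
    0 ≤ ⨆ p : CStarSeminorm (Cc B), p.toSeminorm x :=
  Real.iSup_nonneg fun p => apply_nonneg p.toSeminorm x

variable (B)

/-- The largest C*-seminorm on the *-algebra of finitely supported sections. -/
def maxSeminorm : CStarSeminorm (Cc B) where
  toFun x := ⨆ p : CStarSeminorm (Cc B), p.toSeminorm x
  map_zero' := by simp
  add_le' x y := ciSup_le fun p => (map_add_le_add p.toSeminorm x y).trans
    (add_le_add (le_ciSup (bddAbove_seminorm x) p) (le_ciSup (bddAbove_seminorm y) p))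
  neg' x := by simp
  smul' c x := by
    simp only [map_smul_eq_mul]
    exact (Real.mul_iSup_of_nonneg (norm_nonneg c) _).symm
  map_mul_le' x y := ciSup_le fun p => (p.map_mul_le' x y).trans
    (mul_le_mul (le_ciSup (bddAbove_seminorm x) p) (le_ciSup (bddAbove_seminorm y) p)
      (apply_nonneg p.toSeminorm y) (iSup_seminorm_nonneg x))
  map_star' x := iSup_congr fun p => p.map_star' x
  map_star_mul_self' x := by
    refine le_antisymm (ciSup_le fun p => ?_) ?_
    · exact (p.map_star_mul_self' x).le.trans
        (pow_le_pow_left₀ (apply_nonneg _ _) (le_ciSup (bddAbove_seminorm x) p) 2)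
    · refine (Real.le_sqrt (iSup_seminorm_nonneg x) (iSup_seminorm_nonneg _)).mp
        (ciSup_le fun p => Real.le_sqrt_of_sq_le ?_)
      exact (p.map_star_mul_self' x).ge.trans (le_ciSup (bddAbove_seminorm (star x * x)) p)

/-- The full cross-sectional C*-algebra `C*(B)`. -/
abbrev FullCStar : Type (max u v) := (maxSeminorm B).Completion

/-- `C*(B)` carries the canonical order of a C*-algebra. -/
instance : PartialOrder (FullCStar B) := CStarAlgebra.spectralOrder _
instance : StarOrderedRing (FullCStar B) := CStarAlgebra.spectralOrderedRing _

variable {B}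

/-- The canonical map of the fibre `B g` into `C*(B)`. -/
def incl {g : G} : B g →ₗ[ℂ] FullCStar B := (maxSeminorm B).toCompletion ∘ₗ single

/-! ### Representations -/

variable (B) in
/-- A representation of the Fell bundle in a C*-algebra. -/
structure Rep (A : Type w) [NonUnitalCStarAlgebra A] where
  toFun : ∀ g, B g →ₗ[ℂ] A
  map_mul : ∀ {g h : G} (a : B g) (b : B h), toFun _ (mul a b) = toFun g a * toFun h b
  map_adj : ∀ {g : G} (a : B g), toFun _ (adj a) = star (toFun g a)

namespace Rep

variable {A : Type w} [NonUnitalCStarAlgebra A] (π : Rep B A)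

/-- A representation is faithful if it is injective on the unit fibre. -/
def Faithful : Prop := Function.Injective (π.toFun 1)

/-- The *-homomorphism on finitely supported sections given by a representation. -/
def onSections : Cc B →⋆ₙₐ[ℂ] A where
  toFun := Cc.lift π.toFun
  map_smul' := _root_.map_smul (Cc.lift π.toFun)
  map_zero' := _root_.map_zero (Cc.lift π.toFun)
  map_add' := _root_.map_add (Cc.lift π.toFun)
  map_mul' x y := by
    induction x using Cc.induction with
    | zero => simp
    | add x x' hx hx' => rw [add_mul, _root_.map_add, _root_.map_add, hx, hx', add_mul]
    | single g a =>
      induction y using Cc.induction with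
      | zero => simp
      | add y y' hy hy' => rw [mul_add, _root_.map_add, _root_.map_add, hy, hy', mul_add]
      | single h b =>
        rw [single_mul_single, Cc.lift_single, Cc.lift_single, Cc.lift_single, π.map_mul]
  map_star' x := by
    induction x using Cc.induction with
    | zero => simp
    | add x x' hx hx' => rw [star_add, _root_.map_add, _root_.map_add, hx, hx', star_add]
    | single g a => rw [star_single, Cc.lift_single, Cc.lift_single, π.map_adj]

theorem norm_onSections_le (x : Cc B) : ‖π.onSections x‖ ≤ (maxSeminorm B).toSeminorm x :=
  let q : CStarSeminorm (Cc B) :=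
    { toFun := fun x => ‖π.onSections x‖
      map_zero' := by simp
      add_le' := fun x y => by rw [_root_.map_add]; exact norm_add_le _ _
      neg' := fun x => by rw [map_neg, norm_neg]
      smul' := fun c x => by rw [_root_.map_smul, norm_smul]
      map_mul_le' := fun x y => by rw [_root_.map_mul]; exact _root_.norm_mul_le _ _
      map_star' := fun x => by rw [map_star, norm_star]
      map_star_mul_self' := fun x => by
        rw [_root_.map_mul, map_star, CStarRing.norm_star_mul_self, sq] }
  le_ciSup (bddAbove_seminorm x) q

/-- The integrated form of a representation of the bundle: the *-homomorphism on `C*(B)` that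
restricts to the given maps on the fibres. -/
def integrated : FullCStar B →⋆ₙₐ[ℂ] A :=
  (maxSeminorm B).extend π.onSections π.norm_onSections_le

theorem integrated_incl {g : G} (b : B g) : π.integrated (incl b) = π.toFun g b :=
  ((maxSeminorm B).extend_toCompletion _ _ _).trans (Cc.lift_single _ b)

end Rep

/-! ### Completely positive maps of Fell bundles -/

variable (B) in
/-- The *-algebra `M_t(B)` of matrices `M` with `M i j` in the fibre over `(t i)⁻¹ * t j`. -/
abbrev Mat {n : ℕ} (t : Fin n → G) : Type v := ∀ i j, B ((t i)⁻¹ * t j)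

/-- The product of `M_t(B)`. -/
def Mat.mul {n : ℕ} {t : Fin n → G} (M N : Mat B t) : Mat B t := fun i j =>
  ∑ k, fcast (by group : (t i)⁻¹ * t k * ((t k)⁻¹ * t j) = (t i)⁻¹ * t j)
    (FellBundle.mul (M i k) (N k j))

/-- The involution of `M_t(B)`. -/
def Mat.adj {n : ℕ} {t : Fin n → G} (M : Mat B t) : Mat B t := fun i j =>
  fcast (by group : ((t j)⁻¹ * t i)⁻¹ = (t i)⁻¹ * t j) (FellBundle.adj (M j i))

/-- Positive elements of the C*-algebra `M_t(B)`. -/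
def Mat.Nonneg {n : ℕ} {t : Fin n → G} (M : Mat B t) : Prop := ∃ N : Mat B t, M = N.adj.mul N

variable {H : Type w} [NormedAddCommGroup H] [InnerProductSpace ℂ H] [CompleteSpace H]

/-- The map `φ^t` induced by `φ` on matrices. -/
def Mat.map {n : ℕ} {t : Fin n → G} (φ : ∀ g, B g →ₗ[ℂ] (H →L[ℂ] H)) (M : Mat B t) :
    CStarMatrix (Fin n) (Fin n) (H →L[ℂ] H) :=
  CStarMatrix.ofMatrix fun i j => φ _ (M i j)

/-- A fibrewise linear map `φ : B → B(H)` is completely positive if all the maps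
`φ^t : M_t(B) → M_n(B(H))` are positive. -/
def IsCP (φ : ∀ g, B g →ₗ[ℂ] (H →L[ℂ] H)) : Prop :=
  ∀ (n : ℕ) (t : Fin n → G) (M : Mat B t), M.Nonneg → 0 ≤ M.map φ

/-- The norm `sup {‖φ b‖ : b ∈ B, ‖b‖ ≤ 1}` of a fibrewise linear map, as a number
in `[0, ∞]`. -/
def bundleNorm (φ : ∀ g, B g →ₗ[ℂ] (H →L[ℂ] H)) : ℝ≥0∞ :=
  ⨆ (g : G) (b : B g) (_ : ‖b‖ ≤ 1), ‖φ g b‖ₑ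

end FellBundle

/-- The operator norm `sup {‖ψ x‖ : ‖x‖ ≤ 1}` of a completely positive map between C*-algebras,
as a number in `[0, ∞]`. -/
def cpNorm {A₁ : Type*} {A₂ : Type*} [NonUnitalCStarAlgebra A₁] [NonUnitalCStarAlgebra A₂]
    [PartialOrder A₁] [PartialOrder A₂] [StarOrderedRing A₁] [StarOrderedRing A₂]
    (ψ : A₁ →CP A₂) : ℝ≥0∞ :=
  ⨆ (x : A₁) (_ : ‖x‖ ≤ 1), ‖ψ x‖ₑ

end

/-!
# Completely positive maps of Fell bundles and cross-sectional C*-algebras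

The target of a completely positive (cp) fibrewise linear map `φ` is allowed to be an arbitrary
C*-algebra `A`. The linear extension `Φ` of `φ` to finitely supported sections then has positive
matrices `(Φ (xᵢ* xⱼ))` (`IsCPInto.isAlgebraicCP`), and the point is that `Φ` is bounded for the
largest C*-seminorm, by the bound `K` of `φ` on the fibres.

*Boundedness on the fibres.* On the unit fibre `φ` is a positive map of C*-algebras, hence bounded.
Every `b` in a fibre factorizes as `k u` with `k = (b b*)^(1/4)` in the unit fibre
(`exists_eq_lact`), and the Cauchy–Schwarz inequality for positive `2 × 2` matrices bounds `φ (k u)`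
(`exists_norm_apply_le_mul_norm`).

*Boundedness on sections.* For a positive functional `f` on `A`, left multiplication on the GNS
space of `f ∘ Φ` is a representation of the bundle, so that `Φ (y* x* x y) ≤ ‖x‖² Φ (y* y)`
(`lift_star_mul_mul_self_le`). For `e`, `e'` in the unit ball of the unit fibre, Cauchy–Schwarz
gives `‖Φ (e* x e')‖² ≤ ‖Φ (e* e)‖ ‖Φ (e'* x* x e')‖ ≤ K² ‖x‖²`, and letting `e` and `e'` run through
an approximate unit yields `‖Φ x‖ ≤ K ‖x‖` (`norm_lift_le`). Hence `Φ` extends to `C*(B)`; complete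
positivity passes to the completion by density, and the norm is the fibrewise one
(`IsCPInto.exists_extension`).

*Lifting through a faithful representation.* If `φ = π ∘ ψ` with `π` faithful on a bundle `C`, then
`π` is isometric on the fibres, and `M_t(C)` is a closed *-subalgebra of matrices over the
target of `π`. It contains the square roots of its positive elements, so `ψ` maps positive
elements of `M_t(B)` to positive elements of `M_t(C)` (`Rep.Faithful.mat_nonneg`). Thus `ψ` is cp as
a map into `C*(C)`, and the extension theorem applies with `A = C*(C)`.
-/

noncomputable section

open Filter Topology

/-! ### Positivity, functional calculus and matrices in C*-algebras -/

section CStarAlgebra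

variable {A : Type*} [NonUnitalCStarAlgebra A] [PartialOrder A] [StarOrderedRing A]

/-- Hermitian functionals that are nonnegative on the positive cone detect positivity: a
self-adjoint element outside the closed cone is separated from it by the Hahn–Banach theorem. -/
theorem CStarAlgebra.nonneg_of_forall_functional {x : A} (hx : IsSelfAdjoint x)
    (h : ∀ F : A →ₗ[ℂ] ℂ, (∀ y, F (star y) = star (F y)) → (∀ y, 0 ≤ y → 0 ≤ (F y).re) →
      0 ≤ (F x).re) : 0 ≤ x := by
  by_contra hx0
  let C : ProperCone ℝ A :=
    { carrier := {a | 0 ≤ a}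
      add_mem' := fun ha hb => add_nonneg ha hb
      zero_mem' := le_rfl
      smul_mem' := fun c a ha => smul_nonneg c.2 ha
      isClosed' := CStarAlgebra.isClosed_nonneg }
  obtain ⟨f, hf, hfx⟩ := C.hyperplane_separation_point (x₀ := x) hx0
  -- Symmetrizing the real functional `f` makes its complexification hermitian.
  let g : A →ₗ[ℝ] ℝ :=
    { toFun := fun a => f (a + star a)
      map_add' := fun a b => by rw [← map_add]; congr 1; rw [star_add]; abel
      map_smul' := fun c a => by simp [mul_add] }
  let F : A →ₗ[ℂ] ℂ := Module.Dual.extendRCLike g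
  have hre (a : A) : (F a).re = f (a + star a) := by
    simp [F, Module.Dual.extendRCLike_apply, g]
  have him (a : A) : (F a).im = - f (Complex.I • a + star (Complex.I • a)) := by
    simp [F, Module.Dual.extendRCLike_apply, g]
  have key := h F (fun y => ?_) (fun y hy => ?_)
  · rw [hre, hx.star_eq, map_add] at key
    linarith
  · apply Complex.ext
    · simp [hre, add_comm]
    · simp [him, star_smul, add_comm]
  · rw [hre, (IsSelfAdjoint.of_nonneg hy).star_eq]
    exact hf _ (add_nonneg hy hy)

/-- A substitute for the square root of `r² - h`, which lies outside a non-unital algebra: it would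
be `r - d`, and the identity says that `(r - d)² = r² - h`. -/
theorem CStarAlgebra.exists_isSelfAdjoint_two_smul_sub_mul_self {h : A} (hh : 0 ≤ h) {r : ℝ}
    (hr : 0 ≤ r) (hn : ‖h‖ ≤ r ^ 2) :
    ∃ d : A, IsSelfAdjoint d ∧ (2 * r) • d - d * d = h := by
  let f : ℝ → ℝ := fun x => r - Real.sqrt (r ^ 2 - x)
  have hf : Continuous f := by fun_prop
  have hf0 : f 0 = 0 := by simp [f, Real.sqrt_sq hr]
  refine ⟨cfcₙ f h, cfcₙ_predicate f h, ?_⟩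
  rw [← cfcₙ_smul (2 * r) f h hf.continuousOn hf0, ← cfcₙ_mul f f h hf.continuousOn hf0
    hf.continuousOn hf0, ← cfcₙ_sub _ _ h (by fun_prop) (by simp [hf0]) (by fun_prop)
    (by simp [hf0])]
  conv_rhs => rw [← cfcₙ_id' ℝ h]
  refine cfcₙ_congr fun x hx => ?_
  have h1 : x ≤ r ^ 2 := (Real.le_norm_self x).trans
    ((NonUnitalIsometricContinuousFunctionalCalculus.norm_quasispectrum_le h hx
      (.of_nonneg hh)).trans hn)
  have h2 := Real.sq_sqrt (sub_nonneg.mpr h1)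
  simp only [f, smul_eq_mul]
  linear_combination -h2

/-- A self-adjoint `k` is a limit of left multiples of `k²`. -/
theorem CStarAlgebra.exists_tendsto_mul_mul_self {k : A} (hk : IsSelfAdjoint k) :
    ∃ r : ℕ → A, Tendsto (fun n => r n * (k * k)) atTop (𝓝 k) := by
  -- A regularization of `x⁻¹`; the error `|x - x² f n x|` is at most `(n + 1)⁻¹` for all real `x`.
  let f (n : ℕ) : ℝ → ℝ := fun x => x / (x ^ 2 + ((n : ℝ) + 1)⁻¹ ^ 2)
  have hpos (n : ℕ) (x : ℝ) : 0 < x ^ 2 + ((n : ℝ) + 1)⁻¹ ^ 2 := by positivity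
  have hf (n) : Continuous (f n) := by
    refine continuous_id.div (by fun_prop) fun x => (hpos n x).ne'
  have hf0 (n) : f n 0 = 0 := by simp [f]
  refine ⟨fun n => cfcₙ (f n) k, ?_⟩
  rw [tendsto_iff_norm_sub_tendsto_zero]
  refine squeeze_zero (fun _ => norm_nonneg _) (g := fun n : ℕ => ((n : ℝ) + 1)⁻¹) (fun n => ?_)
    (by simpa using tendsto_one_div_add_atTop_nhds_zero_nat (𝕜 := ℝ))
  have e : cfcₙ (f n) k * (k * k) - k = cfcₙ (fun x => f n x * (x * x) - x) k := by
    have := (hf n).continuousOn (s := quasispectrum ℝ k)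
    rw [cfcₙ_sub _ _ k (by fun_prop) (by simp) (by fun_prop) rfl, cfcₙ_mul _ _ k (by fun_prop)
      (hf0 n) (by fun_prop) (by simp), cfcₙ_mul _ _ k (by fun_prop) rfl (by fun_prop) rfl,
      cfcₙ_id' ℝ k]
  rw [e]
  refine norm_cfcₙ_le fun x _ => ?_
  set ε := ((n : ℝ) + 1)⁻¹
  have hε : 0 < ε := by positivity
  have e2 : f n x * (x * x) - x = - (ε * (x * ε)) / (x ^ 2 + ε ^ 2) := by
    have : x ^ 2 + ε ^ 2 ≠ 0 := (hpos n x).ne'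
    change x / (x ^ 2 + ε ^ 2) * (x * x) - x = _
    field_simp
    ring
  rw [e2, Real.norm_eq_abs, abs_div, abs_of_pos (hpos n x), div_le_iff₀ (hpos n x), abs_neg,
    abs_mul, abs_of_pos hε]
  have : |x * ε| ≤ x ^ 2 + ε ^ 2 := by
    rw [abs_le]; constructor <;> nlinarith [sq_nonneg (x + ε), sq_nonneg (x - ε)]
  gcongr

theorem CStarAlgebra.exists_isSelfAdjoint_pow_four {h : A} (hh : 0 ≤ h) :
    ∃ k : A, IsSelfAdjoint k ∧ (k * k) * (k * k) = h := by
  refine ⟨CFC.sqrt (CFC.sqrt h), .of_nonneg (CFC.sqrt_nonneg _), ?_⟩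
  rw [CFC.sqrt_mul_sqrt_self _ (CFC.sqrt_nonneg _), CFC.sqrt_mul_sqrt_self _ hh]

theorem CStarAlgebra.nonneg_iff_exists_star_mul_self {a : A} :
    0 ≤ a ↔ ∃ b, a = star b * b :=
  CStarAlgebra.nonneg_iff_eq_star_mul_self

namespace CStarMatrix

variable {m n : Type*} [Fintype m] [Fintype n]

theorem nonneg_iff_exists {M : CStarMatrix n n A} :
    0 ≤ M ↔ ∃ Y : n → n → A, ∀ i j, M i j = ∑ l, star (Y l i) * Y l j := by
  rw [CStarAlgebra.nonneg_iff_exists_star_mul_self]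
  refine exists_congr fun Y => ?_
  rw [← CStarMatrix.ext_iff]
  rfl

/-- `Y* Y` is positive for a rectangular matrix `Y`. -/
theorem ofMatrix_star_mul_nonneg (Y : m → n → A) :
    0 ≤ (ofMatrix (Matrix.of fun i j => ∑ l, star (Y l i) * Y l j) : CStarMatrix n n A) := by
  classical
  let Z (l : m) : CStarMatrix n n A := ofMatrix (Matrix.of fun i j => star (Y l i) * Y l j)
  have e : (ofMatrix (Matrix.of fun i j => ∑ l, star (Y l i) * Y l j) : CStarMatrix n n A) =
      ∑ l, Z l := by
    ext i j
    exact (Matrix.sum_apply i j Finset.univ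
      fun l => Matrix.of fun i j => star (Y l i) * Y l j).symm
  rw [e]
  refine Finset.sum_nonneg fun l _ => nonneg_iff_exists.mpr ?_
  -- The contribution of row `l` is `Z* Z` for the square matrix `Z` whose only nonzero row is
  -- that one.
  rcases isEmpty_or_nonempty n with hn | ⟨⟨i₀⟩⟩
  · exact ⟨0, fun i => isEmptyElim i⟩
  · refine ⟨fun p j => if p = i₀ then Y l j else 0, fun i j => ?_⟩
    rw [Finset.sum_eq_single i₀ (by intro p _ hp; simp [hp]) (by simp)]
    simp [Z]

/-- Conjugating a positive matrix by a scalar matrix `V`, possibly rectangular, gives a positive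
matrix. -/
theorem compress_nonneg {M : CStarMatrix n n A} (hM : 0 ≤ M) (V : n → m → ℂ) :
    0 ≤ (ofMatrix (Matrix.of fun i j => ∑ p, ∑ q, (star (V p i) * V q j) • M p q) :
      CStarMatrix m m A) := by
  obtain ⟨Y, hY⟩ := nonneg_iff_exists.mp hM
  convert ofMatrix_star_mul_nonneg fun l i => ∑ p, V p i • Y l p using 1
  ext i j
  simp only [ofMatrix_apply, Matrix.of_apply, hY, star_sum, Finset.sum_mul_sum, Finset.smul_sum,
    star_smul, smul_mul_smul_comm]
  exact Finset.sum_comm_cycle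

theorem diag_nonneg {M : CStarMatrix n n A} (hM : 0 ≤ M) (i : n) : 0 ≤ M i i := by
  obtain ⟨Y, hY⟩ := nonneg_iff_exists.mp hM
  rw [hY]
  exact Finset.sum_nonneg fun l _ => star_mul_self_nonneg _

/-- The off-diagonal entries of a positive matrix are controlled by the diagonal, by the
Cauchy–Schwarz inequality in the Hilbert module of columns. -/
theorem norm_sq_le_of_nonneg {M : CStarMatrix n n A} (hM : 0 ≤ M) (i j : n) :
    ‖M i j‖ ^ 2 ≤ ‖M i i‖ * ‖M j j‖ := by
  obtain ⟨Y, hY⟩ := nonneg_iff_exists.mp hM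
  let v (i : n) : WithCStarModule A (n → A) :=
    (WithCStarModule.equiv A (n → A)).symm fun l => star (Y l i)
  have hv (i j : n) : M i j = inner A (v j) (v i) := by
    rw [hY, WithCStarModule.pi_inner]
    simp [v, WithCStarModule.inner_def]
  have h1 (i : n) : ‖v i‖ ^ 2 = ‖M i i‖ := by rw [hv, CStarModule.norm_sq_eq A]
  rw [← h1, ← h1, ← mul_pow, hv, mul_comm]
  gcongr
  exact CStarModule.norm_inner_le _

end CStarMatrix

end CStarAlgebra

/-! ### The unit fibre, and factorization in the fibres -/

namespace FellBundle

variable {G : Type u} [Group G] {B : G → Type v} [∀ g, NormedAddCommGroup (B g)]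
  [∀ g, NormedSpace ℂ (B g)] [∀ g, CompleteSpace (B g)] [FellBundle B]

theorem single_injective {g : G} : Function.Injective (single : B g → Cc B) := by
  classical exact DirectSum.of_injective g

variable (B) in
/-- The fibre over the unit. A type synonym, so that its C*-algebra structure can be an instance. -/
def UnitFibre : Type v := B (1 : G)

instance : NonUnitalCStarAlgebra (UnitFibre B) := unitFibre B
instance : PartialOrder (UnitFibre B) := CStarAlgebra.spectralOrder _
instance : StarOrderedRing (UnitFibre B) := CStarAlgebra.spectralOrderedRing _

variable (B) in
/-- The inclusion of the unit fibre into the finitely supported sections. -/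
def unitHom : UnitFibre B →⋆ₙₐ[ℂ] Cc B where
  toFun a := single (show B (1 : G) from a)
  map_smul' c a := map_smul (single (B := B) (g := 1)) c a
  map_zero' := map_zero (single (B := B) (g := 1))
  map_add' a b := map_add (single (B := B) (g := 1)) a b
  map_mul' _ _ := (single_congr (sigma_fcast _ _)).trans (single_mul_single _ _).symm
  map_star' _ := (single_congr (sigma_fcast _ _)).trans (star_single _).symm

theorem unitHom_apply (a : B (1 : G)) : unitHom B a = single a := rfl

theorem unitHom_injective : Function.Injective (unitHom B) :=
  fun _ _ h => single_injective (g := (1 : G)) h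

/-- The left action of the unit fibre on the fibre over `g`. -/
def lact {g : G} (a : UnitFibre B) (b : B g) : B g := fcast (one_mul g) (mul (g := 1) a b)

theorem single_lact {g : G} (a : UnitFibre B) (b : B g) :
    single (lact a b) = unitHom B a * single b :=
  (single_congr (sigma_fcast _ _)).trans (single_mul_single _ _).symm

/-- The element `b* b` of the unit fibre. -/
theorem exists_unitHom_eq_star_mul_self {g : G} (b : B g) :
    ∃ c : UnitFibre B, 0 ≤ c ∧ ‖c‖ = ‖b‖ ^ 2 ∧ unitHom B c = star (single b) * single b := by
  let d : B (1 : G) := fcast (inv_mul_cancel g) (mul (adj b) b)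
  have hd : unitHom B d = star (single b) * single b := by
    rw [star_single, single_mul_single]
    exact single_congr (sigma_fcast _ _)
  refine ⟨d, ?_, (norm_eq_of_sigma_eq B (sigma_fcast _ _)).trans (norm_adj_mul_self b), hd⟩
  obtain ⟨c, hc⟩ := adj_mul_self_nonneg b
  let c' : UnitFibre B := c
  refine CStarAlgebra.nonneg_iff_exists_star_mul_self.mpr ⟨c', unitHom_injective (hd.trans ?_)⟩
  rw [map_mul, map_star, unitHom_apply c, star_single, star_single, single_mul_single,
    single_mul_single]
  exact single_congr hc

/-- The element `b b*` of the unit fibre. -/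
theorem exists_unitHom_eq_mul_star_self {g : G} (b : B g) :
    ∃ c : UnitFibre B, 0 ≤ c ∧ ‖c‖ = ‖b‖ ^ 2 ∧ unitHom B c = single b * star (single b) := by
  obtain ⟨c, h0, h1, h2⟩ := exists_unitHom_eq_star_mul_self (adj b)
  exact ⟨c, h0, by rw [h1, norm_adj], by rw [h2, ← star_single, star_star]⟩

theorem smul_add_mul_mul_star {E : Type*} [NonUnitalRing E] [StarRing E] [Module ℂ E]
    [IsScalarTower ℂ E E] [SMulCommClass ℂ E E] [StarModule ℂ E] (z : ℂ) (s b : E) :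
    (z • b + s * b) * star (z • b + s * b) = (z * star z) • (b * star b) +
      z • ((b * star b) * star s) + star z • (s * (b * star b)) + s * (b * star b) * star s := by
  simp only [star_add, star_smul, star_mul, mul_add, add_mul, smul_mul_assoc, mul_smul_comm,
    _root_.mul_assoc, smul_smul, smul_add]
  rw [mul_comm (star z) z]
  abel

/-- If `b b* = q²`, then multiplying `b` on the left by elements of the unitization of the unit
fibre has the same effect on norms as multiplying `q`. -/
theorem norm_smul_add_lact {g : G} {b : B g} {q : UnitFibre B} (hq : IsSelfAdjoint q)
    (hqb : unitHom B (q * q) = single b * star (single b)) (z : ℂ) (s : UnitFibre B) :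
    ‖z • b + lact s b‖ = ‖z • q + s * q‖ := by
  obtain ⟨c, -, hc, hcw⟩ := exists_unitHom_eq_mul_star_self (z • b + lact s b)
  have e : c = (z • q + s * q) * star (z • q + s * q) := by
    apply unitHom_injective
    rw [hcw, smul_add_mul_mul_star, map_add, map_smul, single_lact, smul_add_mul_mul_star,
      hq.star_eq]
    rw [map_add, map_add, map_add, map_smul, map_smul, map_smul, map_mul _ (q * q) (star s),
      map_mul _ (s * (q * q)) (star s), map_mul _ s (q * q), hqb, map_star]
  rw [e, CStarRing.norm_self_mul_star, ← sq] at hc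
  exact ((pow_left_inj₀ (norm_nonneg _) (norm_nonneg _) two_ne_zero).mp hc).symm

/-- A self-adjoint fourth root `k` of `b b*`. -/
theorem exists_isSelfAdjoint_pow_four {g : G} (b : B g) :
    ∃ k : UnitFibre B, IsSelfAdjoint k ∧ ‖k‖ ^ 2 = ‖b‖ ∧
      unitHom B ((k * k) * (k * k)) = single b * star (single b) := by
  obtain ⟨c, h0, h1, h2⟩ := exists_unitHom_eq_mul_star_self b
  obtain ⟨k, hk, rfl⟩ := CStarAlgebra.exists_isSelfAdjoint_pow_four h0
  refine ⟨k, hk, ?_, h2⟩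
  have hkk : IsSelfAdjoint (k * k) := by simpa [hk.star_eq] using IsSelfAdjoint.star_mul_self k
  rw [hkk.norm_mul_self, hk.norm_mul_self] at h1
  exact (pow_left_inj₀ (by positivity) (norm_nonneg _) two_ne_zero).mp h1

theorem norm_lact_le {g : G} (a : UnitFibre B) (b : B g) : ‖lact a b‖ ≤ ‖a‖ * ‖b‖ :=
  (norm_eq_of_sigma_eq B (sigma_fcast _ _)).trans_le (norm_mul_le (g := 1) a b)

theorem lact_sub {g : G} (a : UnitFibre B) (b c : B g) : lact a (b - c) = lact a b - lact a c :=
  single_injective (by simp [single_lact, mul_sub])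

theorem sub_lact {g : G} (a a' : UnitFibre B) (b : B g) :
    lact (a - a') b = lact a b - lact a' b :=
  single_injective (by simp [single_lact, sub_mul])

theorem lact_lact {g : G} (a a' : UnitFibre B) (b : B g) :
    lact a (lact a' b) = lact (a * a') b :=
  single_injective (by simp [single_lact, _root_.mul_assoc])

/-- Factorization: every element of a fibre is `k u` with `k` self-adjoint in the unit fibre, and
the norm of `b` is shared equally between the factors. Here `k = (b b*)^(1/4)`, and `u` is the limit
of `rₙ b`, where `rₙ` plays the role of `k⁻¹`. -/
theorem exists_eq_lact {g : G} (b : B g) :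
    ∃ (k : UnitFibre B) (u : B g), IsSelfAdjoint k ∧ b = lact k u ∧
      ‖k‖ ^ 2 = ‖b‖ ∧ ‖u‖ ^ 2 = ‖b‖ := by
  obtain ⟨k, hk, hn, hkb⟩ := exists_isSelfAdjoint_pow_four b
  have hq : IsSelfAdjoint (k * k) := by simpa [hk.star_eq] using IsSelfAdjoint.star_mul_self k
  obtain ⟨r, hr⟩ := CStarAlgebra.exists_tendsto_mul_mul_self hk
  have hlact (s : UnitFibre B) : ‖lact s b‖ = ‖s * (k * k)‖ := by
    simpa using norm_smul_add_lact hq hkb 0 s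
  -- The sequence `r n * k ^ 2` converges to `k`, and `lact · b` is isometric to `· * k ^ 2`.
  have hcauchy : CauchySeq fun n => lact (r n) b := by
    refine (Metric.cauchySeq_iff.mpr fun ε hε => ?_)
    obtain ⟨N, hN⟩ := Metric.cauchySeq_iff.mp hr.cauchySeq ε hε
    refine ⟨N, fun m hm n hn => ?_⟩
    rw [dist_eq_norm, ← sub_lact, hlact, sub_mul, ← dist_eq_norm]
    exact hN m hm n hn
  obtain ⟨u, hu⟩ := cauchySeq_tendsto_of_complete hcauchy
  refine ⟨k, u, hk, ?_, hn, ?_⟩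
  · have h1 : Tendsto (fun n => b - lact k (lact (r n) b)) atTop (𝓝 (b - lact k u)) := by
      refine tendsto_const_nhds.sub (tendsto_iff_norm_sub_tendsto_zero.mpr ?_)
      refine squeeze_zero (fun _ => norm_nonneg _)
        (g := fun n => ‖k‖ * ‖lact (r n) b - u‖)
        (fun n => by rw [← lact_sub]; exact norm_lact_le _ _) ?_
      simpa using (tendsto_iff_norm_sub_tendsto_zero.mp hu).const_mul ‖k‖
    have h2 : Tendsto (fun n => b - lact k (lact (r n) b)) atTop (𝓝 0) := by
      rw [tendsto_zero_iff_norm_tendsto_zero]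
      have h3 : Tendsto (fun n => ‖k * k - k * (r n * (k * k))‖) atTop (𝓝 ‖k * k - k * k‖) :=
        (tendsto_const_nhds.sub (hr.const_mul k)).norm
      rw [sub_self, norm_zero] at h3
      refine h3.congr fun n => ?_
      have := norm_smul_add_lact hq hkb (-1) (k * r n)
      rw [lact_lact, ← norm_neg, ← norm_neg (b - _)]
      simpa [_root_.mul_assoc, add_comm, sub_eq_add_neg] using this.symm
    exact sub_eq_zero.mp (tendsto_nhds_unique h1 h2)
  · have h1 : ‖u‖ = ‖k‖ := tendsto_nhds_unique hu.norm (by simpa only [hlact] using hr.norm)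
    rw [h1, hn]

theorem tendsto_lact_approximateUnit {g : G} (b : B g) :
    Tendsto (fun e => lact e b) (CStarAlgebra.approximateUnit (UnitFibre B)) (𝓝 b) := by
  obtain ⟨k, hk, -, hkb⟩ := exists_isSelfAdjoint_pow_four b
  have hq : IsSelfAdjoint (k * k) := by simpa [hk.star_eq] using IsSelfAdjoint.star_mul_self k
  have h := tendsto_iff_norm_sub_tendsto_zero.mp
    ((CStarAlgebra.increasingApproximateUnit (UnitFibre B)).tendsto_mul_right (k * k))
  refine tendsto_iff_norm_sub_tendsto_zero.mpr (h.congr fun e => ?_)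
  have := norm_smul_add_lact hq hkb (-1) e
  simpa [add_comm, sub_eq_add_neg] using this.symm

end FellBundle

/-! ### Algebraic complete positivity on sections -/

section

variable {A : Type*} [NonUnitalCStarAlgebra A] [PartialOrder A] [StarOrderedRing A]
variable {E : Type*} [NonUnitalRing E] [StarRing E] [Module ℂ E]

/-- A linear map `Ψ` from a *-algebra to a C*-algebra is completely positive in the algebraic sense
if all matrices `(Ψ (xᵢ* xⱼ))` are positive. -/
def IsAlgebraicCP (Ψ : E →ₗ[ℂ] A) : Prop :=
  ∀ (k : ℕ) (x : Fin k → E), 0 ≤ (CStarMatrix.ofMatrix (Matrix.of fun i j =>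
    Ψ (star (x i) * x j)) : CStarMatrix (Fin k) (Fin k) A)

namespace IsAlgebraicCP

variable {Ψ : E →ₗ[ℂ] A} (hΨ : IsAlgebraicCP Ψ)
include hΨ

theorem map_star_mul_self_nonneg (x : E) : 0 ≤ Ψ (star x * x) :=
  CStarMatrix.diag_nonneg (hΨ 1 fun _ => x) 0

theorem star_map_star_mul (x y : E) : star (Ψ (star x * y)) = Ψ (star y * x) :=
  CStarMatrix.star_apply_of_isSelfAdjoint (IsSelfAdjoint.of_nonneg (hΨ 2 ![x, y])) (i := 0) (j := 1)

/-- The Cauchy–Schwarz inequality for algebraically completely positive maps. -/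
theorem norm_map_star_mul_sq_le (x y : E) :
    ‖Ψ (star x * y)‖ ^ 2 ≤ ‖Ψ (star x * x)‖ * ‖Ψ (star y * y)‖ :=
  CStarMatrix.norm_sq_le_of_nonneg (hΨ 2 ![x, y]) 0 1

end IsAlgebraicCP

end

namespace FellBundle

variable {G : Type u} [Group G] {B : G → Type v} [∀ g, NormedAddCommGroup (B g)]
  [∀ g, NormedSpace ℂ (B g)] [∀ g, CompleteSpace (B g)] [FellBundle B]
  {A : Type w} [NonUnitalCStarAlgebra A] [PartialOrder A] [StarOrderedRing A]

/-- Complete positivity of a fibrewise linear map with values in an arbitrary C*-algebra. -/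
def IsCPInto (φ : ∀ g, B g →ₗ[ℂ] A) : Prop :=
  ∀ (n : ℕ) (t : Fin n → G) (M : Mat B t), M.Nonneg →
    0 ≤ (CStarMatrix.ofMatrix fun i j => φ _ (M i j) : CStarMatrix (Fin n) (Fin n) A)

/-- Products in `M_t(B)` become ordinary matrix products once the entries are regarded as
sections. -/
theorem single_matMul {n : ℕ} {t : Fin n → G} (M N : Mat B t) (i j : Fin n) :
    single (M.mul N i j) = ∑ k, single (M i k) * single (N k j) := by
  rw [Mat.mul, map_sum]
  refine Finset.sum_congr rfl fun k _ => ?_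
  rw [single_mul_single]
  exact single_congr (sigma_fcast _ _)

theorem single_matAdj {n : ℕ} {t : Fin n → G} (M : Mat B t) (i j : Fin n) :
    single (M.adj i j) = star (single (M j i)) := by
  rw [star_single]
  exact single_congr (sigma_fcast _ _)

/-- Finitely many sections are combinations, with a scalar coefficient matrix, of one finite family
of elements of the fibres. -/
theorem exists_sum_smul_single {k : ℕ} (x : Fin k → Cc B) :
    ∃ (n : ℕ) (t : Fin n → G) (b : ∀ p, B (t p)) (V : Fin n → Fin k → ℂ),
      ∀ i, x i = ∑ p, V p i • single (b p) := by
  classical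
  let F : Finset G := Finset.univ.biUnion fun i => DFinsupp.support (x i)
  let e := Fintype.equivFin (Fin k × F)
  refine ⟨_, fun p => (e.symm p).2, fun p => x (e.symm p).1 (e.symm p).2,
    fun p i => if (e.symm p).1 = i then 1 else 0, fun i => ?_⟩
  have h1 : x i = ∑ g ∈ F, single (x i g) := by
    conv_lhs => rw [← DirectSum.sum_support_of (x i)]
    refine Finset.sum_subset (fun g hg => ?_) fun g _ hg => ?_
    · exact Finset.mem_biUnion.mpr ⟨i, Finset.mem_univ _, hg⟩
    · rw [DFinsupp.notMem_support_iff] at hg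
      rw [hg, map_zero]
  rw [Equiv.sum_comp e.symm fun p : Fin k × F =>
    (if p.1 = i then (1 : ℂ) else 0) • single (x p.1 p.2), Fintype.sum_prod_type,
    Finset.sum_eq_single i (by intro j _ hj; simp [hj]) (by simp)]
  simp only [if_true, one_smul]
  rw [h1]
  convert (Finset.sum_coe_sort F fun g => single (x i g)).symm
  rw [← h1]

/-- Complete positivity over the matrix algebras `M_t(B)` is algebraic complete positivity on
sections. After splitting the sections into elements `b p` of fibres, the matrix of all
`φ ((b p)* (b q))` is a corner of the image of an element `N* N`, and the matrix in question is a
compression of it. -/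
theorem IsCPInto.isAlgebraicCP {φ : ∀ g, B g →ₗ[ℂ] A} (hφ : IsCPInto φ) :
    IsAlgebraicCP (Cc.lift φ) := by
  intro k x
  obtain ⟨n, t, b, V, hx⟩ := exists_sum_smul_single x
  -- The row `(b p)` is the first row of a matrix `N` over the tuple `(1, t)`.
  let t' : Fin (n + 1) → G := Fin.cons 1 t
  let N : Mat B t' := fun i => Fin.cases (motive := fun i => ∀ j, B ((t' i)⁻¹ * t' j))
    (fun j => Fin.cases (motive := fun j => B ((t' 0)⁻¹ * t' j)) 0
      (fun p => fcast (by simp [t']) (b p)) j) (fun _ _ => 0) i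
  have hN0 (p : Fin n) : single (N 0 p.succ) = single (b p) := single_congr (sigma_fcast _ _)
  have hNs (l p : Fin n) : single (N l.succ p.succ) = 0 := map_zero _
  have hpos := hφ (n + 1) t' (N.adj.mul N) ⟨N, rfl⟩
  have key := CStarMatrix.compress_nonneg hpos
    (Fin.cases (motive := fun _ => Fin k → ℂ) 0 V)
  refine le_of_le_of_eq key ?_
  ext i j
  change ∑ p : Fin (n + 1), ∑ q : Fin (n + 1), (_ : A) = Cc.lift φ (star (x i) * x j)
  rw [Fin.sum_univ_succ]
  simp only [Fin.cases_zero, Fin.cases_succ, Pi.zero_apply, star_zero, zero_mul, zero_smul,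
    Finset.sum_const_zero, zero_add]
  rw [hx, hx, star_sum, Finset.sum_mul_sum, map_sum]
  refine Finset.sum_congr rfl fun p _ => ?_
  rw [Fin.sum_univ_succ, map_sum]
  simp only [Fin.cases_zero, Fin.cases_succ, Pi.zero_apply, mul_zero, zero_smul, zero_add]
  refine Finset.sum_congr rfl fun q _ => ?_
  rw [star_smul, smul_mul_smul_comm, map_smul]
  congr 1
  change φ _ (N.adj.mul N p.succ q.succ) = _
  rw [← Cc.lift_single φ, single_matMul, Fin.sum_univ_succ, single_matAdj, hN0, hN0]
  simp [hNs]

/-- The restriction to the unit fibre, as a positive linear map of C*-algebras. -/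
def unitRestrict {φ : ∀ g, B g →ₗ[ℂ] A} (hφ : IsAlgebraicCP (Cc.lift φ)) : UnitFibre B →ₚ[ℂ] A :=
  .mk₀ (Cc.lift φ ∘ₗ (unitHom B : UnitFibre B →ₗ[ℂ] Cc B)) fun a ha => by
    obtain ⟨c, rfl⟩ := CStarAlgebra.nonneg_iff_exists_star_mul_self.mp ha
    have h := hφ.map_star_mul_self_nonneg (unitHom B c)
    rwa [← map_star, ← map_mul] at h

section Bound

variable {φ : ∀ g, B g →ₗ[ℂ] A} (hφ : IsAlgebraicCP (Cc.lift φ))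
include hφ

/-- A completely positive map commutes with the involution: by factorization every `b` in a fibre is of the
form `k* u`, and the matrix entries `φ (k* u)`, `φ (u* k)` are adjoint to each other. -/
theorem lift_star (x : Cc B) : Cc.lift φ (star x) = star (Cc.lift φ x) := by
  induction x using Cc.induction with
  | zero => simp
  | add x y hx hy => simp [hx, hy]
  | single g b =>
    obtain ⟨k, u, hk, rfl, -, -⟩ := exists_eq_lact b
    have h := hφ.star_map_star_mul (unitHom B k) (single u)
    rw [← map_star (unitHom B), hk.star_eq] at h
    rw [single_lact, h, star_mul, ← map_star (unitHom B), hk.star_eq]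

/-- Uniform boundedness on the fibres. On the unit fibre the map is positive, hence bounded; on the
other fibres, factorize `b = k u` and apply the Cauchy–Schwarz inequality. -/
theorem exists_norm_apply_le_mul_norm :
    ∃ K : ℝ, 0 ≤ K ∧ ∀ (g : G) (b : B g), ‖φ g b‖ ≤ K * ‖b‖ := by
  obtain ⟨K, hK⟩ := (unitRestrict hφ).exists_norm_apply_le
  have hK' (a : UnitFibre B) : ‖Cc.lift φ (unitHom B a)‖ ≤ K * ‖a‖ := hK a
  refine ⟨K, K.2, fun g b => ?_⟩
  obtain ⟨k, u, hk, hb, hkn, hun⟩ := exists_eq_lact b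
  obtain ⟨c, -, hc, hcu⟩ := exists_unitHom_eq_star_mul_self u
  have h := hφ.norm_map_star_mul_sq_le (unitHom B k) (single u)
  have h1 := hK' (star k * k)
  have h2 := hK' c
  rw [map_mul, map_star, CStarRing.norm_star_mul_self, ← sq, hkn] at h1
  rw [hcu, hc, hun] at h2
  rw [← map_star, hk.star_eq, ← single_lact, ← hb, Cc.lift_single] at h
  rw [← map_star, hk.star_eq] at h1
  refine (pow_le_pow_iff_left₀ (norm_nonneg _) (by positivity) two_ne_zero).mp (h.trans ?_)
  rw [sq]
  gcongr

end Bound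

end FellBundle

/-! ### The GNS construction for functionals on sections -/

namespace FellBundle

variable {G : Type u} [Group G] {B : G → Type v} [∀ g, NormedAddCommGroup (B g)]
  [∀ g, NormedSpace ℂ (B g)] [∀ g, CompleteSpace (B g)] [FellBundle B]

variable (B) in
/-- A positive hermitian linear functional on the *-algebra of finitely supported sections. -/
structure PosFunctional extends Cc B →ₗ[ℂ] ℂ where
  map_star : ∀ x, toFun (star x) = star (toFun x)
  nonneg : ∀ x, 0 ≤ (toFun (star x * x)).re

namespace PosFunctional

variable (F : PosFunctional B)

/-- The sections, regarded as the semi-inner product space with `⟪x, y⟫ = F (x* y)`. -/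
def PreGNS (_F : PosFunctional B) : Type (max u v) := Cc B

instance : AddCommGroup F.PreGNS := inferInstanceAs (AddCommGroup (Cc B))
instance : Module ℂ F.PreGNS := inferInstanceAs (Module ℂ (Cc B))

/-- The identity map from the sections to the semi-inner product space. -/
def toPre : Cc B ≃ₗ[ℂ] F.PreGNS := LinearEquiv.refl ℂ _

/-- The semi-inner product `⟪x, y⟫ = F (x* y)`. -/
abbrev core : PreInnerProductSpace.Core ℂ F.PreGNS where
  inner x y := F.toFun (star (F.toPre.symm x) * F.toPre.symm y)
  conj_inner_symm x y := by
    rw [← RCLike.star_def, ← F.map_star, star_mul, star_star]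
  re_inner_nonneg x := F.nonneg _
  add_left x y z := by
    rw [map_add, star_add, add_mul]; exact map_add F.toLinearMap _ _
  smul_left x y c := by
    rw [map_smul, star_smul, smul_mul_assoc]; exact map_smul F.toLinearMap _ _

instance : SeminormedAddCommGroup F.PreGNS :=
  InnerProductSpace.Core.toSeminormedAddCommGroup (c := F.core)
instance : InnerProductSpace ℂ F.PreGNS := InnerProductSpace.ofCore F.core

theorem inner_toPre (x y : Cc B) : inner ℂ (F.toPre x) (F.toPre y) = F.toFun (star x * y) := rfl

theorem norm_toPre_sq (x : Cc B) : ‖F.toPre x‖ ^ 2 = (F.toFun (star x * x)).re := by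
  rw [← inner_toPre]; exact (inner_self_eq_norm_sq (𝕜 := ℂ) _).symm

/-- Left multiplication by `b` is bounded by `‖b‖`: writing `b* b = 2‖b‖d - d²`, the difference
`‖b‖² y* y - y* b* b y` is `z* z` for the section `z = ‖b‖ y - d y`. -/
theorem norm_toPre_single_mul_le {g : G} (b : B g) (y : Cc B) :
    ‖F.toPre (single b * y)‖ ≤ ‖b‖ * ‖F.toPre y‖ := by
  obtain ⟨c, hc0, hc, hcb⟩ := exists_unitHom_eq_star_mul_self b
  obtain ⟨d, hd, hdc⟩ := CStarAlgebra.exists_isSelfAdjoint_two_smul_sub_mul_self hc0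
    (norm_nonneg b) hc.le
  have hpos := F.nonneg ((‖b‖ : ℂ) • y - unitHom B d * y)
  have hs : star (unitHom B d) = unitHom B d := by
    rw [← StarHomClass.map_star (unitHom B), hd.star_eq]
  have hdc' : (2 * (‖b‖ : ℂ)) • unitHom B d - unitHom B d * unitHom B d =
      star (single b) * single b := by
    rw [← hcb, ← hdc, map_sub, _root_.map_mul, ← map_smul]
    congr 2
    rw [← Complex.coe_smul]; push_cast; rfl
  have e : star ((‖b‖ : ℂ) • y - unitHom B d * y) * ((‖b‖ : ℂ) • y - unitHom B d * y) =
      ((‖b‖ ^ 2 : ℝ) : ℂ) • (star y * y) - star (single b * y) * (single b * y) := by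
    rw [star_mul (single b), _root_.mul_assoc (star y), ← _root_.mul_assoc (star (single b)),
      ← hdc', star_sub, star_smul, star_mul, hs]
    simp only [mul_sub, sub_mul, smul_mul_assoc, mul_smul_comm, _root_.mul_assoc, smul_sub,
      Complex.star_def, Complex.conj_ofReal, Complex.ofReal_pow]
    module
  rw [e] at hpos
  have h2 : F.toFun (((‖b‖ ^ 2 : ℝ) : ℂ) • (star y * y) - star (single b * y) * (single b * y)) =
      ((‖b‖ ^ 2 : ℝ) : ℂ) * F.toFun (star y * y) -
        F.toFun (star (single b * y) * (single b * y)) := by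
    exact (map_sub F.toLinearMap _ _).trans (congrArg (· - _) (map_smul F.toLinearMap _ _))
  rw [h2, Complex.sub_re, Complex.re_ofReal_mul, ← norm_toPre_sq, ← norm_toPre_sq] at hpos
  refine (pow_le_pow_iff_left₀ (norm_nonneg _) (by positivity) two_ne_zero).mp ?_
  rw [mul_pow]
  linarith

/-- Left multiplication by an element of a fibre, on the semi-inner product space. -/
def leftMul {g : G} (b : B g) : F.PreGNS →L[ℂ] F.PreGNS :=
  LinearMap.mkContinuous
    (F.toPre.toLinearMap ∘ₗ LinearMap.mulLeft ℂ (single b) ∘ₗ F.toPre.symm.toLinearMap) ‖b‖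
    fun y => F.norm_toPre_single_mul_le b (F.toPre.symm y)

theorem leftMul_toPre {g : G} (b : B g) (y : Cc B) :
    F.leftMul b (F.toPre y) = F.toPre (single b * y) := rfl

/-- The Hilbert space of the GNS construction. -/
abbrev GNS : Type (max u v) := UniformSpace.Completion F.PreGNS

/-- The canonical map from sections to the GNS space. -/
def toGNS (y : Cc B) : F.GNS := (F.toPre y : F.GNS)

theorem toGNS_add (x y : Cc B) : F.toGNS (x + y) = F.toGNS x + F.toGNS y :=
  (congrArg _ (map_add F.toPre x y)).trans (UniformSpace.Completion.coe_add _ _)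

theorem toGNS_smul (c : ℂ) (x : Cc B) : F.toGNS (c • x) = c • F.toGNS x := by
  rw [toGNS, map_smul]
  exact UniformSpace.Completion.coe_smul _ _

theorem completion_leftMul_toGNS {g : G} (b : B g) (y : Cc B) :
    (F.leftMul b).completion (F.toGNS y) = F.toGNS (single b * y) :=
  ContinuousLinearMap.completion_apply_coe _ _

theorem clm_ext {S T : F.GNS →L[ℂ] F.GNS} (h : ∀ y, S (F.toGNS y) = T (F.toGNS y)) : S = T := by
  ext z
  induction z using UniformSpace.Completion.induction_on with
  | hp => exact isClosed_eq S.continuous T.continuous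
  | ih z => exact h (F.toPre.symm z)

/-- The GNS representation of the bundle on the completed space, by left multiplication. -/
def gnsRep : Rep B (F.GNS →L[ℂ] F.GNS) where
  toFun g :=
    { toFun := fun b => (F.leftMul b).completion
      map_add' := fun b c => F.clm_ext fun y => by
        rw [add_apply, completion_leftMul_toGNS, completion_leftMul_toGNS,
          completion_leftMul_toGNS, map_add, add_mul, toGNS_add]
      map_smul' := fun c b => F.clm_ext fun y => by
        rw [RingHom.id_apply, smul_apply, completion_leftMul_toGNS, completion_leftMul_toGNS,
          map_smul, smul_mul_assoc, toGNS_smul] }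
  map_mul b c := F.clm_ext fun y => by
    simp only [LinearMap.coe_mk, AddHom.coe_mk, mul_apply_eq_comp,
      completion_leftMul_toGNS, ← single_mul_single, _root_.mul_assoc]
  map_adj b := by
    refine (ContinuousLinearMap.eq_adjoint_iff _ _).mpr fun x y => ?_
    induction x, y using UniformSpace.Completion.induction_on₂ with
    | hp => apply isClosed_eq <;> fun_prop
    | ih x y =>
      simp only [LinearMap.coe_mk, AddHom.coe_mk, ContinuousLinearMap.completion_apply_coe,
        UniformSpace.Completion.inner_coe]
      obtain ⟨x, rfl⟩ := F.toPre.surjective x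
      obtain ⟨y, rfl⟩ := F.toPre.surjective y
      rw [leftMul_toPre, leftMul_toPre, inner_toPre, inner_toPre, ← star_single, star_mul,
        star_star, _root_.mul_assoc]

theorem onSections_gnsRep (x y : Cc B) : F.gnsRep.onSections x (F.toGNS y) = F.toGNS (x * y) := by
  induction x using Cc.induction with
  | zero =>
    rw [map_zero, zero_apply, zero_mul, toGNS, map_zero]
    exact UniformSpace.Completion.coe_zero.symm
  | add x x' hx hx' => rw [map_add, add_apply, hx, hx', add_mul, toGNS_add]
  | single g b =>
    have : F.gnsRep.onSections (single b) = (F.leftMul b).completion := Cc.lift_single _ b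
    rw [this, completion_leftMul_toGNS]

/-- A positive functional satisfies `F (y* x* x y) ≤ ‖x‖² F (y* y)` with the largest C*-seminorm,
since left multiplication on its GNS space is a representation of the bundle. -/
theorem map_star_mul_mul_self_le (x y : Cc B) :
    (F.toFun (star (x * y) * (x * y))).re ≤
      (maxSeminorm B).toSeminorm x ^ 2 * (F.toFun (star y * y)).re := by
  have hn (z : Cc B) : ‖F.toGNS z‖ = ‖F.toPre z‖ := UniformSpace.Completion.norm_coe _
  rw [← norm_toPre_sq, ← norm_toPre_sq, ← mul_pow, ← hn, ← hn, ← onSections_gnsRep]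
  gcongr
  exact (ContinuousLinearMap.le_opNorm _ _).trans
    (mul_le_mul_of_nonneg_right (F.gnsRep.norm_onSections_le x) (norm_nonneg _))

end PosFunctional

/-! ### Boundedness for the largest C*-seminorm -/

section Bound

variable {A : Type w} [NonUnitalCStarAlgebra A] [PartialOrder A] [StarOrderedRing A]
  {φ : ∀ g, B g →ₗ[ℂ] A} (hφ : IsAlgebraicCP (Cc.lift φ))
include hφ

/-- The operator inequality `Φ (y* x* x y) ≤ ‖x‖² Φ (y* y)`, tested against positive functionals. -/
theorem lift_star_mul_mul_self_le (x y : Cc B) :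
    Cc.lift φ (star (x * y) * (x * y)) ≤
      ((maxSeminorm B).toSeminorm x ^ 2) • Cc.lift φ (star y * y) := by
  rw [← sub_nonneg]
  have h1 := hφ.map_star_mul_self_nonneg (x * y)
  have h2 := hφ.map_star_mul_self_nonneg y
  refine CStarAlgebra.nonneg_of_forall_functional
    (.sub (.smul (.all _) (.of_nonneg h2)) (.of_nonneg h1)) fun f hf hpos => ?_
  let F : PosFunctional B :=
    { f ∘ₗ Cc.lift φ with
      map_star := fun x => by
        change f (Cc.lift φ (star x)) = star (f (Cc.lift φ x))
        rw [lift_star hφ, hf]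
      nonneg := fun x => hpos _ (hφ.map_star_mul_self_nonneg x) }
  have h : (f (Cc.lift φ (star (x * y) * (x * y)))).re ≤
      (maxSeminorm B).toSeminorm x ^ 2 * (f (Cc.lift φ (star y * y))).re :=
    F.map_star_mul_mul_self_le x y
  rw [map_sub, LinearMap.map_smul_of_tower, Complex.sub_re, Complex.smul_re, smul_eq_mul]
  linarith

theorem tendsto_lift_unitHom_mul {K : ℝ} (hK : ∀ (g : G) (b : B g), ‖φ g b‖ ≤ K * ‖b‖)
    (x : Cc B) : Tendsto (fun e => Cc.lift φ (unitHom B e * x))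
      (CStarAlgebra.approximateUnit (UnitFibre B)) (𝓝 (Cc.lift φ x)) := by
  induction x using Cc.induction with
  | zero => simp
  | add x y hx hy => simpa only [mul_add, map_add] using hx.add hy
  | single g b =>
    simp only [← single_lact, Cc.lift_single]
    rw [tendsto_iff_norm_sub_tendsto_zero]
    refine squeeze_zero (fun _ => norm_nonneg _)
      (fun e => (by rw [← map_sub]; exact hK g _ : _ ≤ K * ‖lact e b - b‖)) ?_
    simpa using (tendsto_iff_norm_sub_tendsto_zero.mp (tendsto_lact_approximateUnit b)).const_mul K

/-- An algebraically completely positive map is bounded on `C*(B)` by its bound on the fibres. -/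
theorem norm_lift_le {K : ℝ} (hK0 : 0 ≤ K) (hK : ∀ (g : G) (b : B g), ‖φ g b‖ ≤ K * ‖b‖)
    (x : Cc B) : ‖Cc.lift φ x‖ ≤ K * (maxSeminorm B).toSeminorm x := by
  -- Bound `e* x e'` for `e`, `e'` in the unit ball of the unit fibre, then remove `e` and `e'` one
  -- at a time by letting them run through an approximate unit.
  have hu : ∀ e : UnitFibre B, ‖e‖ ≤ 1 → ‖Cc.lift φ (star (unitHom B e) * unitHom B e)‖ ≤ K := by
    intro e he
    rw [← map_star, ← map_mul]
    refine (congrArg _ (Cc.lift_single φ (g := 1) (star e * e : UnitFibre B))).trans_le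
      ((hK 1 _).trans (mul_le_of_le_one_right hK0 ?_))
    change ‖star e * e‖ ≤ 1
    rw [CStarRing.norm_star_mul_self]
    exact mul_le_one₀ he (norm_nonneg _) he
  have h1 (x : Cc B) (e e' : UnitFibre B) (he : ‖e‖ ≤ 1) (he' : ‖e'‖ ≤ 1) :
      ‖Cc.lift φ (star (unitHom B e) * (x * unitHom B e'))‖ ≤
        K * (maxSeminorm B).toSeminorm x := by
    have hp := apply_nonneg (maxSeminorm B).toSeminorm x
    refine (pow_le_pow_iff_left₀ (norm_nonneg _) (by positivity) two_ne_zero).mp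
      ((hφ.norm_map_star_mul_sq_le _ _).trans ?_)
    have h2 := CStarAlgebra.norm_le_norm_of_nonneg_of_le (hφ.map_star_mul_self_nonneg _)
      (lift_star_mul_mul_self_le hφ x (unitHom B e'))
    rw [norm_smul, Real.norm_of_nonneg (by positivity)] at h2
    calc _ ≤ K * ((maxSeminorm B).toSeminorm x ^ 2 * K) :=
          mul_le_mul (hu e he) (h2.trans (by gcongr; exact hu e' he')) (norm_nonneg _) hK0
      _ = _ := by ring
  have hl := CStarAlgebra.increasingApproximateUnit (UnitFibre B)
  have h2 (x : Cc B) (e' : UnitFibre B) (he' : ‖e'‖ ≤ 1) :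
      ‖Cc.lift φ (x * unitHom B e')‖ ≤ K * (maxSeminorm B).toSeminorm x := by
    refine le_of_tendsto (tendsto_lift_unitHom_mul hφ hK (x * unitHom B e')).norm ?_
    filter_upwards [hl.eventually_norm, hl.eventually_star_eq] with e he hs
    have := h1 x e e' he he'
    rwa [← map_star, hs] at this
  refine le_of_tendsto (tendsto_lift_unitHom_mul hφ hK x).norm ?_
  filter_upwards [hl.eventually_norm, hl.eventually_star_eq] with e he hs
  -- Only limits of left multiples are available, so the right factor is moved by the involution.
  have := h2 (star x) e he
  rw [← norm_star, ← lift_star hφ, star_mul, star_star, ← map_star, hs] at this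
  exact this.trans_eq (congrArg _ ((maxSeminorm B).map_star' x))

end Bound

end FellBundle

/-! ### Extension to the cross-sectional C*-algebra -/

/-- On a C*-algebra, algebraic complete positivity is complete positivity. -/
def IsAlgebraicCP.toCompletelyPositiveMap {A : Type*} [NonUnitalCStarAlgebra A] [PartialOrder A]
    [StarOrderedRing A] {E : Type*} [NonUnitalCStarAlgebra E] [PartialOrder E] [StarOrderedRing E]
    (Ψ : E →ₗ[ℂ] A) (hΨ : IsAlgebraicCP Ψ) : E →CP A where
  toLinearMap := Ψ
  map_cstarMatrix_nonneg' k M hM := by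
    obtain ⟨Y, hY⟩ := CStarMatrix.nonneg_iff_exists.mp hM
    refine (Finset.sum_nonneg fun l (_ : l ∈ Finset.univ) => hΨ k (Y l)).trans_eq ?_
    ext i j
    rw [CStarMatrix.map_apply, hY, map_sum]
    exact Matrix.sum_apply i j Finset.univ
      fun l => Matrix.of fun i j => Ψ (star (Y l i) * Y l j)

namespace FellBundle

variable {G : Type u} [Group G] {B : G → Type v} [∀ g, NormedAddCommGroup (B g)]
  [∀ g, NormedSpace ℂ (B g)] [∀ g, CompleteSpace (B g)] [FellBundle B]

theorem norm_incl_le {g : G} (b : B g) : ‖(incl b : FullCStar B)‖ ≤ ‖b‖ :=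
  ((maxSeminorm B).norm_toCompletion _).trans_le (seminorm_single_le _ b)

/-- Continuous linear maps on `C*(B)` are determined by their restrictions to the fibres. -/
theorem fullCStar_ext {X : Type*} [TopologicalSpace X] [T2Space X] [AddCommMonoid X] [Module ℂ X]
    {S T : FullCStar B →ₗ[ℂ] X} (hS : Continuous S) (hT : Continuous T)
    (h : ∀ (g : G) (b : B g), S (incl b) = T (incl b)) : S = T := by
  ext z
  refine (maxSeminorm B).completion_induction z (isClosed_eq hS hT) fun x => ?_
  induction x using Cc.induction with
  | zero => simp only [map_zero]
  | add x y hx hy => simp only [map_add, hx, hy]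
  | single g b => exact h g b

section

variable {A : Type w} [NonUnitalCStarAlgebra A]

/-- The extension to `C*(B)` of a linear map on sections that is bounded for the largest
C*-seminorm. -/
def extendBounded (f : Cc B →ₗ[ℂ] A) (K : ℝ)
    (hf : ∀ x, ‖f x‖ ≤ K * (maxSeminorm B).toSeminorm x) : FullCStar B →L[ℂ] A :=
  ContinuousLinearMap.fromCompletion
    (LinearMap.mkContinuous (show (maxSeminorm B).Pre →ₗ[ℂ] A from f) K hf)

theorem extendBounded_toCompletion (f : Cc B →ₗ[ℂ] A) (K : ℝ)
    (hf : ∀ x, ‖f x‖ ≤ K * (maxSeminorm B).toSeminorm x) (x : Cc B) :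
    extendBounded f K hf ((maxSeminorm B).toCompletion x) = f x :=
  ContinuousLinearMap.fromCompletion_apply_coe _ _

theorem norm_extendBounded_le (f : Cc B →ₗ[ℂ] A) (K : ℝ)
    (hf : ∀ x, ‖f x‖ ≤ K * (maxSeminorm B).toSeminorm x) (z : FullCStar B) :
    ‖extendBounded f K hf z‖ ≤ K * ‖z‖ :=
  (maxSeminorm B).completion_induction z (isClosed_le (by fun_prop) (by fun_prop)) fun x => by
    rw [extendBounded_toCompletion, CStarSeminorm.norm_toCompletion]; exact hf x

variable [PartialOrder A] [StarOrderedRing A]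

theorem isAlgebraicCP_extendBounded {f : Cc B →ₗ[ℂ] A} (hcp : IsAlgebraicCP f) (K : ℝ)
    (hf : ∀ x, ‖f x‖ ≤ K * (maxSeminorm B).toSeminorm x) :
    IsAlgebraicCP (extendBounded f K hf : FullCStar B →ₗ[ℂ] A) := by
  intro k x
  have hd : DenseRange fun (y : Fin k → Cc B) i => (maxSeminorm B).toCompletion (y i) :=
    .piMap fun _ => (maxSeminorm B).denseRange_toCompletion
  have hs : Continuous fun x : FullCStar B => star x := (maxSeminorm B).continuous_star'
  refine hd.induction_on (p := fun x : Fin k → FullCStar B => 0 ≤ (CStarMatrix.ofMatrix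
    (Matrix.of fun i j => (extendBounded f K hf : FullCStar B →ₗ[ℂ] A) (star (x i) * x j)) :
      CStarMatrix (Fin k) (Fin k) A)) x ?_ fun y => ?_
  · have hc : Continuous fun (x : Fin k → FullCStar B) (i j : Fin k) =>
        extendBounded f K hf (star (x i) * x j) :=
      continuous_pi fun i => continuous_pi fun j => (extendBounded f K hf).continuous.comp
        ((hs.comp (continuous_apply i)).mul (continuous_apply j))
    exact (CStarAlgebra.isClosed_nonneg (A := CStarMatrix (Fin k) (Fin k) A)).preimage hc
  · refine (hcp k y).trans_eq ?_
    ext i j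
    refine (extendBounded_toCompletion f K hf _).symm.trans ?_
    rw [CStarSeminorm.toCompletion_mul, CStarSeminorm.toCompletion_star]
    rfl

theorem norm_apply_le_of_iSup_enorm {φ : ∀ g, B g →ₗ[ℂ] A}
    (hfin : (⨆ (g : G) (b : B g) (_ : ‖b‖ ≤ 1), ‖φ g b‖ₑ) < ⊤) (g : G) (b : B g) :
    ‖φ g b‖ ≤ (⨆ (g : G) (b : B g) (_ : ‖b‖ ≤ 1), ‖φ g b‖ₑ).toReal * ‖b‖ := by
  rcases eq_or_ne b 0 with rfl | hb
  · simp
  have hb' : 0 < ‖b‖ := norm_pos_iff.mpr hb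
  have h1 : ‖φ g ((‖b‖ : ℂ)⁻¹ • b)‖ₑ ≤ ⨆ (g : G) (b : B g) (_ : ‖b‖ ≤ 1), ‖φ g b‖ₑ :=
    le_iSup_of_le g (le_iSup₂_of_le ((‖b‖ : ℂ)⁻¹ • b)
      (by simp [norm_smul, hb'.ne']) le_rfl)
  have h2 := ENNReal.toReal_mono hfin.ne h1
  rw [toReal_enorm, map_smul, norm_smul, norm_inv, Complex.norm_real, norm_norm] at h2
  rwa [inv_mul_le_iff₀ hb', mul_comm] at h2

/-- A completely positive fibrewise linear map is bounded and extends to a completely positive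
map on `C*(B)` of the same norm. -/
theorem IsCPInto.exists_extension {φ : ∀ g, B g →ₗ[ℂ] A} (hφ : IsCPInto φ) :
    (⨆ (g : G) (b : B g) (_ : ‖b‖ ≤ 1), ‖φ g b‖ₑ) < ⊤ ∧
    ∃ Φ : FullCStar B →CP A, (∀ (g : G) (b : B g), Φ (incl b) = φ g b) ∧
      cpNorm Φ = ⨆ (g : G) (b : B g) (_ : ‖b‖ ≤ 1), ‖φ g b‖ₑ := by
  have hcp := hφ.isAlgebraicCP
  have hfin : (⨆ (g : G) (b : B g) (_ : ‖b‖ ≤ 1), ‖φ g b‖ₑ) < ⊤ := by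
    obtain ⟨K, hK0, hK⟩ := exists_norm_apply_le_mul_norm hcp
    refine lt_of_le_of_lt (iSup_le fun g => iSup₂_le fun b hb => ?_)
      (ENNReal.ofReal_lt_top (r := K))
    rw [← ofReal_norm]
    exact ENNReal.ofReal_le_ofReal ((hK g b).trans (mul_le_of_le_one_right hK0 hb))
  refine ⟨hfin, ?_⟩
  set S := ⨆ (g : G) (b : B g) (_ : ‖b‖ ≤ 1), ‖φ g b‖ₑ with hS
  have hK := norm_lift_le hcp ENNReal.toReal_nonneg (norm_apply_le_of_iSup_enorm hfin)
  have hincl (g : G) (b : B g) : extendBounded _ _ hK (incl b) = φ g b :=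
    (extendBounded_toCompletion _ _ hK _).trans (Cc.lift_single φ b)
  refine ⟨(isAlgebraicCP_extendBounded hcp _ hK).toCompletelyPositiveMap, hincl, le_antisymm ?_ ?_⟩
  · refine iSup₂_le fun x hx => ?_
    change ‖extendBounded _ _ hK x‖ₑ ≤ S
    rw [← ENNReal.ofReal_toReal hfin.ne, ← ofReal_norm]
    exact ENNReal.ofReal_le_ofReal ((norm_extendBounded_le _ _ hK x).trans
      (mul_le_of_le_one_right ENNReal.toReal_nonneg hx))
  · refine iSup_le fun g => iSup₂_le fun b hb => ?_
    rw [← hincl g b]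
    exact le_iSup₂_of_le (f := fun (x : FullCStar B) (_ : ‖x‖ ≤ 1) => ‖extendBounded _ _ hK x‖ₑ)
      (incl b) ((norm_incl_le b).trans hb) le_rfl

end

end FellBundle

/-! ### Faithful representations and matrices over a bundle -/

/-- A positive element of a closed *-subalgebra has the form `y* y` with `y` in the subalgebra. -/
theorem CStarAlgebra.exists_mem_eq_star_mul_self {A : Type*} [NonUnitalCStarAlgebra A]
    [PartialOrder A] [StarOrderedRing A] (S : NonUnitalStarSubalgebra ℂ A)
    (hS : IsClosed (S : Set A)) {z : A} (hz : 0 ≤ z) (hzS : z ∈ S) :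
    ∃ y ∈ S, z = star y * y := by
  refine ⟨CFC.sqrt z, ?_, ?_⟩
  · rw [CFC.sqrt_eq_real_sqrt z]
    exact cfcₙ_mem (𝕜' := ℂ) (hs := hS) _ hzS
  · rw [(IsSelfAdjoint.of_nonneg (CFC.sqrt_nonneg z)).star_eq, CFC.sqrt_mul_sqrt_self z hz]

namespace FellBundle

variable {G : Type u} [Group G] {C : G → Type x} [∀ g, NormedAddCommGroup (C g)]
  [∀ g, NormedSpace ℂ (C g)] [∀ g, CompleteSpace (C g)] [FellBundle C]
  {X : Type w} [NonUnitalCStarAlgebra X]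

namespace Rep

variable (π : Rep C X)

theorem onSections_single {g : G} (c : C g) : π.onSections (single c) = π.toFun g c :=
  Cc.lift_single _ c

theorem toFun_matMul {n : ℕ} {t : Fin n → G} (M N : Mat C t) (i j : Fin n) :
    π.toFun _ (M.mul N i j) = ∑ k, π.toFun _ (M i k) * π.toFun _ (N k j) := by
  simp only [← onSections_single, single_matMul, _root_.map_sum, _root_.map_mul]

theorem toFun_matAdj {n : ℕ} {t : Fin n → G} (M : Mat C t) (i j : Fin n) :
    π.toFun _ (M.adj i j) = star (π.toFun _ (M j i)) := by
  rw [← onSections_single, single_matAdj, map_star, onSections_single]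

variable (C) in
/-- The canonical representation of a Fell bundle in its cross-sectional C*-algebra. -/
def universal : Rep C (FullCStar C) where
  toFun _ := incl
  map_mul a b := by
    rw [incl, incl, incl, LinearMap.comp_apply, ← single_mul_single,
      CStarSeminorm.toCompletion_mul]; rfl
  map_adj a := by
    rw [incl, incl, LinearMap.comp_apply, ← star_single, CStarSeminorm.toCompletion_star]; rfl

variable {π}

/-- A faithful representation is isometric on every fibre, because it is so on the unit fibre. -/
theorem Faithful.norm_toFun (hπ : π.Faithful) {g : G} (c : C g) : ‖π.toFun g c‖ = ‖c‖ := by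
  obtain ⟨d, -, hd, hdc⟩ := exists_unitHom_eq_star_mul_self c
  have hinj : Function.Injective (π.onSections.comp (unitHom C)) := by
    intro a b hab
    exact hπ ((π.onSections_single (g := 1) a).symm.trans
      (hab.trans (π.onSections_single (g := 1) b)))
  have h := NonUnitalStarAlgHom.norm_map _ hinj d
  rw [NonUnitalStarAlgHom.comp_apply, hdc, _root_.map_mul, map_star, onSections_single,
    CStarRing.norm_star_mul_self, hd, ← sq] at h
  exact (pow_left_inj₀ (norm_nonneg _) (norm_nonneg _) two_ne_zero).mp h

theorem Faithful.isometry (hπ : π.Faithful) (g : G) : Isometry (π.toFun g) :=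
  AddMonoidHomClass.isometry_of_norm _ hπ.norm_toFun

variable [PartialOrder X] [StarOrderedRing X]

variable (π) in
/-- The image of the matrix algebra `M_t(C)` under a representation, as a *-subalgebra. -/
def matRange {n : ℕ} (t : Fin n → G) :
    NonUnitalStarSubalgebra ℂ (CStarMatrix (Fin n) (Fin n) X) where
  carrier := {Y | ∃ M : Mat C t, ∀ i j, Y i j = π.toFun _ (M i j)}
  add_mem' := by
    rintro Y Z ⟨M, hM⟩ ⟨N, hN⟩
    exact ⟨M + N, fun i j => by
      rw [CStarMatrix.add_apply, hM, hN]; exact (_root_.map_add _ _ _).symm⟩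
  zero_mem' := ⟨0, fun i j => (_root_.map_zero _).symm⟩
  mul_mem' := by
    rintro Y Z ⟨M, hM⟩ ⟨N, hN⟩
    exact ⟨M.mul N, fun i j => by simp only [CStarMatrix.mul_apply, toFun_matMul, hM, hN]⟩
  smul_mem' := by
    rintro c Y ⟨M, hM⟩
    exact ⟨c • M, fun i j => by
      rw [CStarMatrix.smul_apply, hM]; exact (_root_.map_smul _ _ _).symm⟩
  star_mem' := by
    rintro Y ⟨M, hM⟩
    exact ⟨M.adj, fun i j => by rw [CStarMatrix.star_apply, toFun_matAdj, hM]⟩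

theorem mem_matRange {n : ℕ} {t : Fin n → G} {Y : CStarMatrix (Fin n) (Fin n) X} :
    Y ∈ π.matRange t ↔ ∃ M : Mat C t, ∀ i j, Y i j = π.toFun _ (M i j) := Iff.rfl

theorem Faithful.isClosed_matRange (hπ : π.Faithful) {n : ℕ} (t : Fin n → G) :
    IsClosed (π.matRange t : Set (CStarMatrix (Fin n) (Fin n) X)) := by
  have e : (π.matRange t : Set (CStarMatrix (Fin n) (Fin n) X)) =
      ⋂ (i) (j), (fun Y : CStarMatrix (Fin n) (Fin n) X => Y i j) ⁻¹'
        Set.range (π.toFun ((t i)⁻¹ * t j)) := by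
    ext Y
    simp only [SetLike.mem_coe, mem_matRange, Set.mem_iInter, Set.mem_preimage, Set.mem_range]
    refine ⟨fun ⟨M, hM⟩ i j => ⟨M i j, (hM i j).symm⟩, fun h => ?_⟩
    choose M hM using h
    exact ⟨M, fun i j => (hM i j).symm⟩
  rw [e]
  refine isClosed_iInter fun i => isClosed_iInter fun j => ?_
  exact (hπ.isometry _).isClosedEmbedding.isClosed_range.preimage
    ((continuous_apply j).comp (continuous_apply (A := fun _ : Fin n => Fin n → X) i))

/-- Positivity in `M_t(C)` can be tested in a faithful representation: the image of `M_t(C)` is a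
C*-subalgebra, and so contains the square root of each of its positive elements. -/
theorem Faithful.mat_nonneg (hπ : π.Faithful) {n : ℕ} {t : Fin n → G} {P : Mat C t}
    (hP : 0 ≤ (CStarMatrix.ofMatrix (Matrix.of fun i j => π.toFun _ (P i j)) :
      CStarMatrix (Fin n) (Fin n) X)) : P.Nonneg := by
  obtain ⟨Y, ⟨Q, hQ⟩, hY⟩ := CStarAlgebra.exists_mem_eq_star_mul_self (π.matRange t)
    (hπ.isClosed_matRange t) hP ⟨P, fun i j => rfl⟩
  refine ⟨Q, funext fun i => funext fun j => (hπ.isometry _).injective ?_⟩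
  refine (CStarMatrix.ext_iff.mpr hY i j).trans ?_
  simp only [CStarMatrix.mul_apply, CStarMatrix.star_apply, toFun_matMul, toFun_matAdj, hQ]

end Rep

variable {B : G → Type v} [∀ g, NormedAddCommGroup (B g)]
  [∀ g, NormedSpace ℂ (B g)] [∀ g, CompleteSpace (B g)] [FellBundle B]
  [PartialOrder X] [StarOrderedRing X]

/-- If a completely positive `φ` factors as `π ∘ ψ` with `π` faithful, then `ψ` is completely
positive as a map into `C*(C)`. -/
theorem Rep.Faithful.isCPInto_incl {π : Rep C X} (hπ : π.Faithful) {φ : ∀ g, B g →ₗ[ℂ] X}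
    (hφ : IsCPInto φ) (ψ : ∀ g, B g →ₗ[ℂ] C g)
    (hψ : ∀ (g : G) (b : B g), π.toFun g (ψ g b) = φ g b) :
    IsCPInto fun g => (incl : C g →ₗ[ℂ] FullCStar C) ∘ₗ ψ g := by
  intro n t M hM
  have h := hφ n t M hM
  simp only [← hψ] at h
  obtain ⟨Q, hQ⟩ := hπ.mat_nonneg (P := fun i j => ψ _ (M i j)) h
  refine (CStarMatrix.ofMatrix_star_mul_nonneg
    fun l i => (Rep.universal C).toFun _ (Q l i)).trans_eq ?_
  ext i j
  have e : ψ _ (M i j) = Q.adj.mul Q i j := congrFun (congrFun hQ i) j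
  change _ = (Rep.universal C).toFun _ (ψ _ (M i j))
  rw [e, Rep.toFun_matMul]
  simp only [Rep.toFun_matAdj]
  rfl

/-- A bundle with a faithful representation embeds isometrically in its cross-sectional
C*-algebra. -/
theorem Rep.Faithful.norm_incl {π : Rep C X} (hπ : π.Faithful) {g : G} (c : C g) :
    ‖(incl c : FullCStar C)‖ = ‖π.toFun g c‖ := by
  refine le_antisymm ((norm_incl_le c).trans_eq (hπ.norm_toFun c).symm) ?_
  rw [← π.integrated_incl]
  exact NonUnitalStarAlgHom.norm_apply_le _ _

end FellBundle

end

open FellBundle in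
theorem mainTheorem7 {G : Type u} [Group G]
    (B : G → Type v) [∀ g, NormedAddCommGroup (B g)] [∀ g, NormedSpace ℂ (B g)]
    [∀ g, CompleteSpace (B g)] [FellBundle B]
    (H : Type w) [NormedAddCommGroup H] [InnerProductSpace ℂ H] [CompleteSpace H]
    (φ : ∀ g, B g →ₗ[ℂ] (H →L[ℂ] H)) (hφ : IsCP φ) :
    bundleNorm φ < ⊤ ∧
    (∃ Φ : FullCStar B →CP (H →L[ℂ] H),
      (∀ (g : G) (b : B g), Φ (incl b) = φ g b) ∧
      cpNorm Φ = bundleNorm φ ∧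
      ∀ Ψ : FullCStar B →CP (H →L[ℂ] H), (∀ (g : G) (b : B g), Ψ (incl b) = φ g b) → Ψ = Φ) ∧
    ∀ (C : G → Type x) [∀ g, NormedAddCommGroup (C g)] [∀ g, NormedSpace ℂ (C g)]
      [∀ g, CompleteSpace (C g)] [FellBundle C] (π : Rep C (H →L[ℂ] H)),
      π.Faithful → (∀ (g : G) (b : B g), ∃ c : C g, φ g b = π.toFun g c) →
      ∃ φ' : FullCStar B →CP FullCStar C,
        cpNorm φ' = bundleNorm φ ∧
        ∀ (g : G) (b : B g), (∃ c : C g, φ' (incl b) = incl c) ∧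
          π.integrated (φ' (incl b)) = φ g b := by
  have hφ' : IsCPInto φ := hφ
  obtain ⟨hfin, Φ, hΦ, hn⟩ := hφ'.exists_extension
  refine ⟨hfin, ⟨Φ, hΦ, hn, fun Ψ hΨ => ?_⟩, ?_⟩
  · have h : Ψ.toLinearMap = Φ.toLinearMap :=
      fullCStar_ext (map_continuous Ψ) (map_continuous Φ) fun g b => (hΨ g b).trans (hΦ g b).symm
    exact DFunLike.ext _ _ fun z => congrArg (fun f => f z) h
  · intro C _ _ _ _ π hπ hC
    -- The lift of `φ` to the fibres of `C`, linear because `π` is injective on each fibre.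
    let ψ (g : G) : B g →ₗ[ℂ] C g :=
      (LinearEquiv.ofInjective (π.toFun g) (hπ.isometry g).injective).symm.toLinearMap ∘ₗ
        (φ g).codRestrict (LinearMap.range (π.toFun g)) fun b => (hC g b).imp fun _ h => h.symm
    have hψ (g : G) (b : B g) : π.toFun g (ψ g b) = φ g b :=
      congrArg Subtype.val ((LinearEquiv.ofInjective (π.toFun g)
        (hπ.isometry g).injective).apply_symm_apply _)
    obtain ⟨-, φ', h1, h2⟩ := (hπ.isCPInto_incl hφ' ψ hψ).exists_extension
    refine ⟨φ', h2.trans ?_, fun g b => ⟨⟨ψ g b, h1 g b⟩, ?_⟩⟩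
    · refine iSup_congr fun g => iSup_congr fun b => iSup_congr fun _ => ?_
      rw [← ofReal_norm, ← ofReal_norm, LinearMap.comp_apply, hπ.norm_incl, hψ]
    · rw [h1, LinearMap.comp_apply, π.integrated_incl, hψ]
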